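/- Let $\Bbbk$ be a field and $C$ a coalgebra over $\Bbbk$. Let $\mathfrak{M}^C$ be the category of right $C$-comodules and $\mathfrak{M}^C_{\mathtt{fd}}$ its full subcategory of finite-dimensional comodules. The dual $C^*$ is an algebra by $\langle fg,c\rangle=\langle f,c_{(1)}\rangle\langle g,c_{(2)}\rangle$; it acts on a right comodule $M$ from the left by $f\rightharpoonup m=\langle f,m_{(1)}\rangle m_{(0)}$ and on $C$ from the right by $c\leftharpoonup f=\langle f,c_{(1)}\rangle c_{(2)}$. Define endofunctors of $\mathfrak{M}^C$ by $$\mathbb{N}^{\mathrm L}_C(M)=\mathrm{Hom}^C(C,M)^{\mathrm{rat}},\qquad \mathbb{N}^{\mathrm R}_C(M)=C\otimes_{C^*}M,$$ where $\mathrm{Hom}^C(C,M)$ is the space of right comodule maps with the left $C^*$-action $(f\cdot\varphi)(c)=\varphi(c\leftharpoonup f)$, $(-)^{\mathrm{rat}}$ is the largest rational submodule of a left $C^*$-module (the largest submodule whose action comes from a right $C$-comodule structure, regarded as that comodule), and $C\otimes_{C^*}M$ has the coaction $c\otimes m\mapsto(c_{(1)}\otimes m)\otimes c_{(2)}$. Let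 $\mathfrak{I}^C_{\mathtt{sf}}\subset\mathfrak{M}^C$ be the full subcategory of injective comodules whose socle has finite length, and let $\mathfrak{P}^C_{\mathtt{fd}}\subset\mathfrak{M}^C$ be the full subcategory of projective objects of $\mathfrak{M}^C_{\mathtt{fd}}$. The coalgebra $C$ is right semiperfect if every finite-dimensional right $C$-comodule has a projective cover in $\mathfrak{M}^C$. **Theorem.** The following are equivalent: 1. $C$ is right semiperfect. 2. $\mathbb{N}^{\mathrm L}_C$ restricts to an equivalence $\mathfrak{I}^C_{\mathtt{sf}}\to\mathfrak{P}^C_{\mathtt{fd}}$, that is, it maps objects of $\mathfrak{I}^C_{\mathtt{sf}}$ to objects of $\mathfrak{P}^C_{\mathtt{fd}}$ and the induced functor is an equivalence. 3. $\mathbb{N}^{\mathrm R}_C$ restricts, in the same sense, to an equivalence $\mathfrak{P}^C_{\mathtt{fd}}\to\mathfrak{I}^C_{\mathtt{sf}}$. If these conditions hold, then the equivalences in (2) and (3) are mutually quasi-inverse. Moreover, every simple right $C$-comodule $S$ then has an injective hull $E(S)$ and a projective cover $P(S)$ in $\mathfrak{M}^C$, and for any such hull and cover $$\mathbb{N}^{\mathrm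 L}_C(E(S))\cong P(S)\qquad\text{and}\qquad \mathbb{N}^{\mathrm R}_C(P(S))\cong E(S).$$ -/

import Mathlib

open CategoryTheory TensorProduct

universe u

/-! ### Right comodules over a coalgebra and their category -/

/-- The dual space `C* = Hom_k(C, k)` of a coalgebra, regarded as an algebra under the convolution
product `⟨f * g, c⟩ = ⟨f, c₍₁₎⟩ ⟨g, c₍₂₎⟩`. -/
abbrev DualAlg (k C : Type u) [Field k] [AddCommGroup C] [Module k C] : Type u :=
  WithConv (C →ₗ[k] k)

/-- A right comodule over the `k`-coalgebra `C`: a vector space `M` with a coassociative and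
counital coaction `M → M ⊗ C`, `m ↦ m₍₀₎ ⊗ m₍₁₎`. -/
structure RComod (k C : Type u) [Field k] [AddCommGroup C] [Module k C] [Coalgebra k C] where
  /-- the underlying vector space -/
  carrier : Type u
  [addCommGroup : AddCommGroup carrier]
  [module : Module k carrier]
  /-- the coaction -/
  coact : carrier →ₗ[k] carrier ⊗[k] C
  coassoc : (TensorProduct.assoc k carrier C C).toLinearMap ∘ₗ coact.rTensor C ∘ₗ coact =
    (Coalgebra.comul (R := k) (A := C)).lTensor carrier ∘ₗ coact
  counit_coact : (TensorProduct.rid k carrier).toLinearMap ∘ₗ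
    (Coalgebra.counit (R := k) (A := C)).lTensor carrier ∘ₗ coact = LinearMap.id

attribute [instance] RComod.addCommGroup RComod.module

namespace RComod

variable {k C : Type u} [Field k] [AddCommGroup C] [Module k C]

/-- The contraction `V ⊗ C → V`, `v ⊗ c ↦ ⟨f, c⟩ v`, against a functional `f` on `C`. -/
noncomputable def contract (V : Type u) [AddCommGroup V] [Module k V] (f : C →ₗ[k] k) :
    V ⊗[k] C →ₗ[k] V :=
  (TensorProduct.rid k V).toLinearMap ∘ₗ f.lTensor V

section contract

variable {V W : Type u} [AddCommGroup V] [Module k V] [AddCommGroup W] [Module k W]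

@[simp] theorem contract_tmul (f : C →ₗ[k] k) (v : V) (c : C) :
    contract V f (v ⊗ₜ[k] c) = f c • v := by
  simp [contract]

theorem contract_rTensor (f : C →ₗ[k] k) (g : V →ₗ[k] W) (t : V ⊗[k] C) :
    contract W f (g.rTensor C t) = g (contract V f t) := by
  induction t with
  | zero => simp
  | tmul v c => simp
  | add x y hx hy => simp [hx, hy]

theorem contract_add (f g : C →ₗ[k] k) (t : V ⊗[k] C) :
    contract V (f + g) t = contract V f t + contract V g t := by
  simp [contract, LinearMap.lTensor_add]

theorem contract_smul (a : k) (f : C →ₗ[k] k) (t : V ⊗[k] C) :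
    contract V (a • f) t = a • contract V f t := by
  simp [contract, LinearMap.lTensor_smul]

theorem eq_zero_of_contract {t : V ⊗[k] C} (h : ∀ f : C →ₗ[k] k, contract V f t = 0) : t = 0 := by
  classical
  let b := Module.Basis.ofVectorSpace k C
  apply (TensorProduct.equivFinsuppOfBasisRight (M := V) b).injective
  rw [map_zero]
  ext i
  have key : ∀ s : V ⊗[k] C,
      TensorProduct.equivFinsuppOfBasisRight b s i = contract V (b.coord i) s := by
    intro s
    induction s with
    | zero => simp
    | tmul v c => simp
    | add x y hx hy => simp [hx, hy]
  rw [key, h]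
  rfl

theorem eq_of_contract {s t : V ⊗[k] C}
    (h : ∀ f : C →ₗ[k] k, contract V f s = contract V f t) : s = t :=
  sub_eq_zero.1 (eq_zero_of_contract fun f => by rw [map_sub, h f, sub_self])

theorem eq_of_contract₂ {s t : V ⊗[k] (C ⊗[k] C)}
    (h : ∀ f g : C →ₗ[k] k,
      contract V f (contract (V ⊗[k] C) g ((TensorProduct.assoc k V C C).symm s)) =
        contract V f (contract (V ⊗[k] C) g ((TensorProduct.assoc k V C C).symm t))) : s = t :=
  (TensorProduct.assoc k V C C).symm.injective
    (eq_of_contract fun g => eq_of_contract fun f => h f g)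

theorem contract_comul [Coalgebra k C] (f g : DualAlg k C) (t : V ⊗[k] C) :
    contract V f.ofConv (contract (V ⊗[k] C) g.ofConv ((TensorProduct.assoc k V C C).symm
      ((Coalgebra.comul (R := k) (A := C)).lTensor V t))) = contract V (f * g).ofConv t := by
  induction t with
  | zero => simp
  | add x y hx hy => simp [hx, hy]
  | tmul v c =>
    simp only [LinearMap.lTensor_tmul, contract_tmul, LinearMap.convMul_apply]
    induction (Coalgebra.comul (R := k) (A := C) c) with
    | zero => simp
    | add x y hx hy => simp only [TensorProduct.tmul_add, map_add, hx, hy, add_smul]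
    | tmul a b =>
      simp only [TensorProduct.assoc_symm_tmul, contract_tmul, map_smul, TensorProduct.map_tmul,
        LinearMap.mul'_apply, smul_smul]
      rw [mul_comm]

end contract

variable [Coalgebra k C]

/-- A morphism of right comodules: a linear map compatible with the coactions. -/
@[ext] structure Hom (M N : RComod k C) where
  /-- the underlying linear map -/
  toLin : M.carrier →ₗ[k] N.carrier
  comm : N.coact ∘ₗ toLin = toLin.rTensor C ∘ₗ M.coact

/-- The category of right `C`-comodules. -/
instance : Category (RComod k C) where
  Hom M N := Hom M N
  id M := ⟨LinearMap.id, by simp⟩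
  comp f g := ⟨g.toLin ∘ₗ f.toLin, by
    rw [← LinearMap.comp_assoc, g.comm, LinearMap.comp_assoc, f.comm, LinearMap.rTensor_comp,
      LinearMap.comp_assoc]⟩

/-- The underlying linear map of a morphism of comodules. -/
abbrev lin {M N : RComod k C} (f : M ⟶ N) : M.carrier →ₗ[k] N.carrier := Hom.toLin f

@[ext] theorem hom_ext {M N : RComod k C} {f g : M ⟶ N} (h : lin f = lin g) : f = g :=
  Hom.ext h

instance (M N : RComod k C) : Zero (M ⟶ N) := ⟨(⟨0, by simp⟩ : Hom M N)⟩

instance (M N : RComod k C) : Add (M ⟶ N) :=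
  ⟨fun f g => (⟨lin f + lin g, by
    rw [LinearMap.comp_add, f.comm, g.comm, LinearMap.rTensor_add, LinearMap.add_comp]⟩ :
      Hom M N)⟩

instance (M N : RComod k C) : Neg (M ⟶ N) :=
  ⟨fun f => (⟨-lin f, by
    rw [LinearMap.comp_neg, f.comm, LinearMap.rTensor_neg, LinearMap.neg_comp]⟩ : Hom M N)⟩

/-- Morphisms of comodules are added pointwise. -/
instance (M N : RComod k C) : AddCommGroup (M ⟶ N) where
  add_assoc f g h := hom_ext (add_assoc (lin f) (lin g) (lin h))
  zero_add f := hom_ext (zero_add (lin f))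
  add_zero f := hom_ext (add_zero (lin f))
  add_comm f g := hom_ext (add_comm (lin f) (lin g))
  neg_add_cancel f := hom_ext (neg_add_cancel (lin f))
  nsmul := nsmulRec
  zsmul := zsmulRec

instance : Preadditive (RComod k C) where
  add_comp _ _ _ f f' g := hom_ext (LinearMap.comp_add (lin f) (lin f') (lin g))
  comp_add _ _ _ f g g' := hom_ext (LinearMap.add_comp (lin f) (lin g') (lin g))

/-! ### Actions of the dual algebra -/

theorem contract_coact_mul (M : RComod k C) (f g : DualAlg k C) (m : M.carrier) :
    contract M.carrier (f * g).ofConv (M.coact m) =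
      contract M.carrier f.ofConv (M.coact (contract M.carrier g.ofConv (M.coact m))) := by
  have h := LinearMap.congr_fun M.coassoc m
  simp only [LinearMap.comp_apply] at h
  rw [← contract_comul, ← h]
  simp [contract_rTensor]

/-- The left action of `C*` on a right comodule, `f ⇀ m = ⟨f, m₍₁₎⟩ m₍₀₎`. -/
noncomputable instance (M : RComod k C) : Module (DualAlg k C) M.carrier where
  smul f m := contract M.carrier f.ofConv (M.coact m)
  one_smul m := by
    have h := LinearMap.congr_fun M.counit_coact m
    exact h
  mul_smul f g m := contract_coact_mul M f g m
  smul_zero f := by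
    change contract M.carrier f.ofConv (M.coact 0) = 0
    simp
  smul_add f m n := by
    change contract M.carrier f.ofConv (M.coact (m + n)) =
      contract M.carrier f.ofConv (M.coact m) + contract M.carrier f.ofConv (M.coact n)
    simp
  add_smul f g m := contract_add f.ofConv g.ofConv (M.coact m)
  zero_smul m := by
    change contract M.carrier (0 : C →ₗ[k] k) (M.coact m) = 0
    simp [contract]

theorem smul_def (M : RComod k C) (f : DualAlg k C) (m : M.carrier) :
    f • m = contract M.carrier f.ofConv (M.coact m) := rfl

instance (M : RComod k C) : IsScalarTower k (DualAlg k C) M.carrier where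
  smul_assoc a f m := contract_smul a f.ofConv (M.coact m)

/-- The right action of `C*` on `C`, `c ↼ f = ⟨f, c₍₁₎⟩ c₍₂₎`. -/
noncomputable def hitRight (f : DualAlg k C) : C →ₗ[k] C :=
  (TensorProduct.lid k C).toLinearMap ∘ₗ f.ofConv.rTensor C ∘ₗ Coalgebra.comul

theorem comul_hitRight (f : DualAlg k C) :
    Coalgebra.comul ∘ₗ hitRight f = (hitRight f).rTensor C ∘ₗ Coalgebra.comul := by
  ext c
  have h := Coalgebra.coassoc_apply (R := k) c
  have h1 : ∀ t : C ⊗[k] C, Coalgebra.comul (R := k)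
      ((TensorProduct.lid k C) (f.ofConv.rTensor C t)) =
      (TensorProduct.lid k (C ⊗[k] C)) (f.ofConv.rTensor (C ⊗[k] C)
        ((Coalgebra.comul (R := k) (A := C)).lTensor C t)) := by
    intro t
    induction t with
    | zero => simp
    | tmul v c => simp
    | add x y hx hy => simp only [map_add, hx, hy]
  have h2 : ∀ t : C ⊗[k] C, (hitRight f).rTensor C t =
      (TensorProduct.lid k (C ⊗[k] C)) (f.ofConv.rTensor (C ⊗[k] C)
        (TensorProduct.assoc k C C C ((Coalgebra.comul (R := k) (A := C)).rTensor C t))) := by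
    intro t
    induction t with
    | zero => simp
    | add x y hx hy => simp only [map_add, hx, hy]
    | tmul v c =>
      simp only [LinearMap.rTensor_tmul, hitRight, LinearMap.comp_apply]
      induction (Coalgebra.comul (R := k) (A := C) v) with
      | zero => simp
      | add x y hx hy => simp only [TensorProduct.add_tmul, map_add, hx, hy]
      | tmul a b => simp [TensorProduct.smul_tmul']
  simp only [LinearMap.comp_apply]
  rw [h2, h, ← h1]
  rfl

theorem hitRight_mul (f g : DualAlg k C) : hitRight (f * g) = hitRight g ∘ₗ hitRight f := by
  ext c
  have h := LinearMap.congr_fun (comul_hitRight f) c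
  simp only [LinearMap.comp_apply] at h ⊢
  conv_rhs => rw [hitRight]
  simp only [LinearMap.comp_apply]
  rw [h]
  conv_lhs => rw [hitRight]
  simp only [LinearMap.comp_apply]
  have key : ∀ t : C ⊗[k] C, (TensorProduct.lid k C) ((f * g).ofConv.rTensor C t) =
      (TensorProduct.lid k C) ((g.ofConv ∘ₗ hitRight f).rTensor C t) := by
    intro t
    induction t with
    | zero => simp
    | add x y hx hy => simp only [map_add, hx, hy]
    | tmul v c =>
      simp only [LinearMap.rTensor_tmul, hitRight, LinearMap.comp_apply, LinearMap.convMul_apply]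
      congr 2
      induction (Coalgebra.comul (R := k) (A := C) v) with
      | zero => simp
      | add x y hx hy => simp only [map_add, hx, hy]
      | tmul a b => simp
  simp [key, LinearMap.rTensor_comp]

/-! ### The rational part of a left module over the dual algebra -/

section rational

variable (k C)
variable (V : Type u) [AddCommGroup V] [Module k V] [Module (DualAlg k C) V]
  [IsScalarTower k (DualAlg k C) V]

/-- The rational part of a left `C*`-module `V`: the elements `v` for which there is a tensor
`∑ vᵢ ⊗ cᵢ` in `V ⊗ C` such that `f • v = ∑ ⟨f, cᵢ⟩ vᵢ` for every `f` in `C*`. -/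
def ratPart : Submodule k V where
  carrier := {v | ∃ t : V ⊗[k] C, ∀ f : DualAlg k C, f • v = contract V f.ofConv t}
  zero_mem' := ⟨0, by simp⟩
  add_mem' := by
    rintro v w ⟨s, hs⟩ ⟨t, ht⟩
    exact ⟨s + t, fun f => by rw [smul_add, hs, ht, map_add]⟩
  smul_mem' := by
    rintro a v ⟨t, ht⟩
    refine ⟨a • t, fun f => ?_⟩
    rw [map_smul, ← ht, ← algebraMap_smul (DualAlg k C) a v,
      ← algebraMap_smul (DualAlg k C) a (f • v), smul_smul, smul_smul, Algebra.commutes]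

variable {V}

theorem smul_mem_ratPart {v : V} (hv : v ∈ ratPart k C V) (f : DualAlg k C) :
    f • v ∈ ratPart k C V := by
  obtain ⟨t, ht⟩ := hv
  refine ⟨contract (V ⊗[k] C) f.ofConv ((TensorProduct.assoc k V C C).symm
      ((Coalgebra.comul (R := k) (A := C)).lTensor V t)), fun g => ?_⟩
  rw [contract_comul, ← ht, mul_smul]

theorem exists_ratCoact (v : ratPart k C V) :
    ∃ t : ratPart k C V ⊗[k] C, ∀ f : DualAlg k C,
      f • (v : V) = (contract (ratPart k C V) f.ofConv t : V) := by
  obtain ⟨t, ht⟩ := v.2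
  have h0 : (ratPart k C V).mkQ.rTensor C t = 0 := by
    refine eq_zero_of_contract fun f => ?_
    rw [contract_rTensor]
    have := ht (WithConv.toConv f)
    change _ = contract V f t at this
    rw [← this, Submodule.mkQ_apply, Submodule.Quotient.mk_eq_zero]
    exact smul_mem_ratPart k C v.2 _
  obtain ⟨s, hs⟩ := (_root_.rTensor_exact C (LinearMap.exact_subtype_mkQ (ratPart k C V))
    (Submodule.mkQ_surjective _) t).1 h0
  refine ⟨s, fun f => ?_⟩
  rw [ht, ← hs, contract_rTensor]
  rfl

variable (V) in
/-- The coaction on the rational part: the unique one inducing the given action of `C*`. -/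
noncomputable def ratCoact : ratPart k C V →ₗ[k] ratPart k C V ⊗[k] C where
  toFun v := (exists_ratCoact k C v).choose
  map_add' v w := eq_of_contract fun f => Subtype.ext <| by
    have h1 := (exists_ratCoact k C (v + w)).choose_spec (WithConv.toConv f)
    have h2 := (exists_ratCoact k C v).choose_spec (WithConv.toConv f)
    have h3 := (exists_ratCoact k C w).choose_spec (WithConv.toConv f)
    refine h1.symm.trans ?_
    rw [map_add, Submodule.coe_add, Submodule.coe_add, smul_add, h2, h3]
  map_smul' a v := eq_of_contract fun f => Subtype.ext <| by
    have h1 := (exists_ratCoact k C (a • v)).choose_spec (WithConv.toConv f)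
    have h2 := (exists_ratCoact k C v).choose_spec (WithConv.toConv f)
    refine h1.symm.trans ?_
    rw [map_smul, RingHom.id_apply, Submodule.coe_smul, Submodule.coe_smul]
    refine Eq.trans ?_ (congrArg (a • ·) h2)
    rw [← algebraMap_smul (DualAlg k C) a (v : V), ← algebraMap_smul (DualAlg k C) a (_ • (v : V)),
      smul_smul, smul_smul, Algebra.commutes]

theorem contract_ratCoact (v : ratPart k C V) (f : DualAlg k C) :
    (contract (ratPart k C V) f.ofConv (ratCoact k C V v) : V) = f • (v : V) :=
  ((exists_ratCoact k C v).choose_spec f).symm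

variable (V) in
/-- The rational part of a left `C*`-module, as a right `C`-comodule. -/
noncomputable def rat : RComod k C where
  carrier := ratPart k C V
  coact := ratCoact k C V
  coassoc := by
    ext1 v
    refine eq_of_contract₂ fun f g => Subtype.ext ?_
    simp only [LinearMap.comp_apply, LinearEquiv.coe_coe, LinearEquiv.symm_apply_apply]
    rw [contract_rTensor]
    have h := contract_comul (V := ratPart k C V) (WithConv.toConv f) (WithConv.toConv g)
      (ratCoact k C V v)
    change contract _ f (contract _ g _) = _ at h
    rw [h]
    have h2 := contract_ratCoact k C (contract (ratPart k C V) g (ratCoact k C V v))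
      (WithConv.toConv f)
    change (contract (ratPart k C V) f _ : V) = _ at h2
    have h3 := contract_ratCoact k C v (WithConv.toConv g)
    change (contract (ratPart k C V) g _ : V) = _ at h3
    refine h2.trans ?_
    rw [h3, contract_ratCoact, mul_smul]
  counit_coact := by
    ext v
    have h := contract_ratCoact k C v 1
    rw [one_smul] at h
    refine Eq.trans ?_ h
    rfl

variable {W : Type u} [AddCommGroup W] [Module k W] [Module (DualAlg k C) W]
  [IsScalarTower k (DualAlg k C) W]

theorem map_mem_ratPart (φ : V →ₗ[DualAlg k C] W) {v : V} (hv : v ∈ ratPart k C V) :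
    φ v ∈ ratPart k C W := by
  obtain ⟨t, ht⟩ := hv
  refine ⟨(φ.restrictScalars k).rTensor C t, fun f => ?_⟩
  rw [contract_rTensor, ← ht, LinearMap.restrictScalars_apply, map_smul]

/-- The restriction of a `C*`-linear map to the rational parts. -/
noncomputable def ratLin (φ : V →ₗ[DualAlg k C] W) : ratPart k C V →ₗ[k] ratPart k C W :=
  (φ.restrictScalars k).restrict fun _ hv => map_mem_ratPart k C φ hv

theorem ratLin_comm (φ : V →ₗ[DualAlg k C] W) :
    ratCoact k C W ∘ₗ ratLin k C φ = (ratLin k C φ).rTensor C ∘ₗ ratCoact k C V := by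
  ext1 v
  refine eq_of_contract fun f => Subtype.ext ?_
  simp only [LinearMap.comp_apply]
  rw [contract_rTensor]
  have h1 := contract_ratCoact k C v (WithConv.toConv f)
  have h2 := contract_ratCoact k C (ratLin k C φ v) (WithConv.toConv f)
  refine h2.trans ?_
  change WithConv.toConv f • φ (v : V) = φ (contract (ratPart k C V) f (ratCoact k C V v) : V)
  rw [← map_smul, ← h1]

/-- The comodule morphism between rational parts which is the restriction of a `C*`-linear map. -/
noncomputable def ratMap (φ : V →ₗ[DualAlg k C] W) : rat k C V ⟶ rat k C W :=
  (⟨ratLin k C φ, ratLin_comm k C φ⟩ : Hom (rat k C V) (rat k C W))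

end rational

/-! ### The left exact Nakayama functor -/

/-- The space `Hom^C(C, M)` of comodule maps from `C` (a right comodule by its comultiplication)
to `M`. -/
def regularHom (M : RComod k C) : Submodule k (C →ₗ[k] M.carrier) where
  carrier := {φ | M.coact ∘ₗ φ = φ.rTensor C ∘ₗ Coalgebra.comul}
  zero_mem' := by simp
  add_mem' := by
    intro φ ψ hφ hψ
    simp only [Set.mem_ofPred_eq] at hφ hψ ⊢
    rw [LinearMap.comp_add, hφ, hψ, LinearMap.rTensor_add, LinearMap.add_comp]
  smul_mem' := by
    intro a φ hφ
    simp only [Set.mem_ofPred_eq] at hφ ⊢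
    rw [LinearMap.comp_smul, hφ, LinearMap.rTensor_smul, LinearMap.smul_comp]

/-- The left action of `C*` on `Hom^C(C, M)`, `(f • φ)(c) = φ(c ↼ f)`. -/
noncomputable instance (M : RComod k C) : Module (DualAlg k C) (regularHom M) where
  smul f φ := ⟨φ.1 ∘ₗ hitRight f, by
    have h : M.coact ∘ₗ φ.1 = φ.1.rTensor C ∘ₗ Coalgebra.comul := φ.2
    change M.coact ∘ₗ φ.1 ∘ₗ hitRight f = (φ.1 ∘ₗ hitRight f).rTensor C ∘ₗ Coalgebra.comul
    rw [← LinearMap.comp_assoc, h, LinearMap.comp_assoc, comul_hitRight, LinearMap.rTensor_comp,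
      LinearMap.comp_assoc]⟩
  one_smul φ := by
    apply Subtype.ext
    ext c
    change φ.1 (hitRight 1 c) = φ.1 c
    congr 1
    have h := Coalgebra.rTensor_counit_comul (R := k) c
    change TensorProduct.lid k C ((Coalgebra.counit (R := k) (A := C)).rTensor C
      (Coalgebra.comul c)) = c
    rw [h]
    simp
  mul_smul f g φ := by
    apply Subtype.ext
    change φ.1 ∘ₗ hitRight (f * g) = (φ.1 ∘ₗ hitRight g) ∘ₗ hitRight f
    rw [hitRight_mul, LinearMap.comp_assoc]
  smul_zero f := Subtype.ext (LinearMap.zero_comp (hitRight f))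
  smul_add f φ ψ := Subtype.ext (LinearMap.add_comp (hitRight f) ψ.1 φ.1)
  add_smul f g φ := by
    apply Subtype.ext
    ext c
    change φ.1 (hitRight (f + g) c) = φ.1 (hitRight f c) + φ.1 (hitRight g c)
    simp [hitRight, LinearMap.rTensor_add]
  zero_smul φ := by
    apply Subtype.ext
    ext c
    change φ.1 (hitRight 0 c) = 0
    simp [hitRight]

theorem regularHom_smul_apply (M : RComod k C) (f : DualAlg k C) (φ : regularHom M) (c : C) :
    (f • φ).1 c = φ.1 (hitRight f c) := rfl

instance (M : RComod k C) : IsScalarTower k (DualAlg k C) (regularHom M) where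
  smul_assoc a f φ := by
    apply Subtype.ext
    ext c
    change φ.1 (hitRight (a • f) c) = a • φ.1 (hitRight f c)
    simp [hitRight, LinearMap.rTensor_smul]

/-- Composition with a comodule morphism, as a `C*`-linear map `Hom^C(C, M) → Hom^C(C, N)`. -/
def regularHomMap {M N : RComod k C} (g : M ⟶ N) :
    regularHom M →ₗ[DualAlg k C] regularHom N where
  toFun φ := ⟨lin g ∘ₗ φ.1, by
    have h : M.coact ∘ₗ φ.1 = φ.1.rTensor C ∘ₗ Coalgebra.comul := φ.2
    change N.coact ∘ₗ lin g ∘ₗ φ.1 = (lin g ∘ₗ φ.1).rTensor C ∘ₗ Coalgebra.comul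
    rw [← LinearMap.comp_assoc, g.comm, LinearMap.comp_assoc, h, LinearMap.rTensor_comp,
      LinearMap.comp_assoc]⟩
  map_add' φ ψ := Subtype.ext (LinearMap.comp_add φ.1 ψ.1 (lin g))
  map_smul' _ _ := rfl

variable (k C) in
/-- The left exact Nakayama functor `M ↦ Hom^C(C, M)^rat`. -/
noncomputable def nakayamaL : RComod k C ⥤ RComod k C where
  obj M := rat k C (regularHom M)
  map g := ratMap k C (regularHomMap g)
  map_id _ := rfl
  map_comp _ _ := rfl

/-! ### The right exact Nakayama functor -/

/-- The relations `(c ↼ f) ⊗ m = c ⊗ (f ⇀ m)` in `C ⊗ M` that define `C ⊗_{C*} M`. -/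
def balancedRel (M : RComod k C) : Submodule k (C ⊗[k] M.carrier) :=
  Submodule.span k {t | ∃ (c : C) (f : DualAlg k C) (m : M.carrier),
    t = hitRight f c ⊗ₜ[k] m - c ⊗ₜ[k] (f • m)}

/-- The balanced tensor product `C ⊗_{C*} M` of the right `C*`-module `C` and the left
`C*`-module `M`. -/
abbrev BalancedTensor (M : RComod k C) : Type u := (C ⊗[k] M.carrier) ⧸ balancedRel M

/-- The map `c ⊗ m ↦ (c₍₁₎ ⊗ m) ⊗ c₍₂₎` on `C ⊗ V`. -/
noncomputable def preCoact (V : Type u) [AddCommGroup V] [Module k V] :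
    C ⊗[k] V →ₗ[k] (C ⊗[k] V) ⊗[k] C :=
  (TensorProduct.rightComm k C C V).toLinearMap ∘ₗ
    (Coalgebra.comul (R := k) (A := C)).rTensor V

theorem balancedRel_le (M : RComod k C) :
    balancedRel M ≤ LinearMap.ker ((balancedRel M).mkQ.rTensor C ∘ₗ preCoact M.carrier) := by
  refine Submodule.span_le.2 ?_
  rintro _ ⟨c, f, m, rfl⟩
  have h := LinearMap.congr_fun (comul_hitRight f) c
  simp only [LinearMap.comp_apply] at h
  simp only [SetLike.mem_coe, LinearMap.mem_ker, LinearMap.comp_apply, map_sub, sub_eq_zero,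
    preCoact, LinearEquiv.coe_coe, LinearMap.rTensor_tmul, h]
  induction (Coalgebra.comul (R := k) (A := C) c) with
  | zero => simp
  | add x y hx hy => simp only [map_add, TensorProduct.add_tmul, hx, hy]
  | tmul a b =>
    simp only [LinearMap.rTensor_tmul, TensorProduct.rightComm_tmul]
    congr 1
    exact (Submodule.Quotient.eq _).2 (Submodule.subset_span ⟨a, f, m, rfl⟩)

/-- The right coaction `c ⊗ m ↦ (c₍₁₎ ⊗ m) ⊗ c₍₂₎` on `C ⊗_{C*} M`. -/
noncomputable def balancedCoact (M : RComod k C) :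
    BalancedTensor M →ₗ[k] BalancedTensor M ⊗[k] C :=
  (balancedRel M).liftQ _ (balancedRel_le M)

theorem balancedCoact_mk (M : RComod k C) (t : C ⊗[k] M.carrier) :
    balancedCoact M ((balancedRel M).mkQ t) =
      (balancedRel M).mkQ.rTensor C (preCoact M.carrier t) := rfl

theorem preCoact_coassoc (V : Type u) [AddCommGroup V] [Module k V] (t : C ⊗[k] V) :
    TensorProduct.assoc k (C ⊗[k] V) C C ((preCoact V).rTensor C (preCoact V t)) =
      (Coalgebra.comul (R := k) (A := C)).lTensor (C ⊗[k] V) (preCoact V t) := by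
  induction t with
  | zero => simp
  | add x y hx hy => simp only [map_add, hx, hy]
  | tmul c v =>
    have h := Coalgebra.coassoc_apply (R := k) c
    let θ : C ⊗[k] (C ⊗[k] C) →ₗ[k] (C ⊗[k] V) ⊗[k] (C ⊗[k] C) :=
      ((TensorProduct.mk k C V).flip v).rTensor (C ⊗[k] C)
    have h1 : ∀ s : C ⊗[k] C,
        TensorProduct.assoc k (C ⊗[k] V) C C ((preCoact V).rTensor C
          (TensorProduct.rightComm k C C V (s ⊗ₜ[k] v))) =
        θ (TensorProduct.assoc k C C C ((Coalgebra.comul (R := k) (A := C)).rTensor C s)) := by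
      intro s
      induction s with
      | zero => simp
      | add x y hx hy => simp only [map_add, TensorProduct.add_tmul, hx, hy]
      | tmul a b =>
        simp only [TensorProduct.rightComm_tmul, LinearMap.rTensor_tmul, preCoact,
          LinearMap.comp_apply, LinearEquiv.coe_coe]
        induction (Coalgebra.comul (R := k) (A := C) a) with
        | zero => simp
        | add x y hx hy => simp only [map_add, TensorProduct.add_tmul, hx, hy]
        | tmul p q => simp [θ]
    have h2 : ∀ s : C ⊗[k] C,
        (Coalgebra.comul (R := k) (A := C)).lTensor (C ⊗[k] V)
          (TensorProduct.rightComm k C C V (s ⊗ₜ[k] v)) =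
        θ ((Coalgebra.comul (R := k) (A := C)).lTensor C s) := by
      intro s
      induction s with
      | zero => simp
      | add x y hx hy => simp only [map_add, TensorProduct.add_tmul, hx, hy]
      | tmul a b => simp [θ]
    have h3 : preCoact V (c ⊗ₜ[k] v) =
        TensorProduct.rightComm k C C V (Coalgebra.comul (R := k) (A := C) c ⊗ₜ[k] v) := rfl
    rw [h3, h1, h2, h]

theorem preCoact_counit (V : Type u) [AddCommGroup V] [Module k V] (t : C ⊗[k] V) :
    contract (C ⊗[k] V) (Coalgebra.counit (R := k) (A := C)) (preCoact V t) = t := by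
  induction t with
  | zero => simp
  | add x y hx hy => simp only [map_add, hx, hy]
  | tmul c v =>
    have h := Coalgebra.lTensor_counit_comul (R := k) c
    have h1 : ∀ s : C ⊗[k] C,
        contract (C ⊗[k] V) (Coalgebra.counit (R := k) (A := C))
          (TensorProduct.rightComm k C C V (s ⊗ₜ[k] v)) =
        (TensorProduct.rid k C ((Coalgebra.counit (R := k) (A := C)).lTensor C s)) ⊗ₜ[k] v := by
      intro s
      induction s with
      | zero => simp
      | add x y hx hy => simp only [map_add, TensorProduct.add_tmul, hx, hy]
      | tmul a b => simp [TensorProduct.smul_tmul']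
    refine (h1 _).trans ?_
    rw [h]
    simp

/-- The right `C`-comodule `C ⊗_{C*} M`. -/
noncomputable def balancedTensor (M : RComod k C) : RComod k C where
  carrier := BalancedTensor M
  coact := balancedCoact M
  coassoc := by
    refine (LinearMap.cancel_right (Submodule.mkQ_surjective (balancedRel M))).1 ?_
    refine TensorProduct.ext' fun c m => ?_
    simp only [LinearMap.comp_apply, LinearEquiv.coe_coe, balancedCoact_mk]
    have h := congrArg ((balancedRel M).mkQ.rTensor (C ⊗[k] C))
      (preCoact_coassoc M.carrier (c ⊗ₜ[k] m))
    have h1 : ∀ s : (C ⊗[k] M.carrier) ⊗[k] C,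
        TensorProduct.assoc k (BalancedTensor M) C C
          ((balancedCoact M).rTensor C ((balancedRel M).mkQ.rTensor C s)) =
        (balancedRel M).mkQ.rTensor (C ⊗[k] C)
          (TensorProduct.assoc k (C ⊗[k] M.carrier) C C ((preCoact M.carrier).rTensor C s)) := by
      intro s
      induction s with
      | zero => simp
      | add x y hx hy => simp only [map_add, hx, hy]
      | tmul a b =>
        simp only [LinearMap.rTensor_tmul, balancedCoact_mk]
        induction (preCoact M.carrier a) with
        | zero => simp
        | add x y hx hy => simp only [map_add, TensorProduct.add_tmul, hx, hy]
        | tmul p q => simp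
    have h2 : ∀ s : (C ⊗[k] M.carrier) ⊗[k] C,
        (Coalgebra.comul (R := k) (A := C)).lTensor (BalancedTensor M)
          ((balancedRel M).mkQ.rTensor C s) =
        (balancedRel M).mkQ.rTensor (C ⊗[k] C)
          ((Coalgebra.comul (R := k) (A := C)).lTensor (C ⊗[k] M.carrier) s) := by
      intro s
      induction s with
      | zero => simp
      | add x y hx hy => simp only [map_add, hx, hy]
      | tmul a b => simp
    rw [h1, h2, h]
  counit_coact := by
    refine (LinearMap.cancel_right (Submodule.mkQ_surjective (balancedRel M))).1 ?_
    refine TensorProduct.ext' fun c m => ?_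
    change contract (BalancedTensor M) (Coalgebra.counit (R := k) (A := C))
      ((balancedRel M).mkQ.rTensor C (preCoact M.carrier (c ⊗ₜ[k] m))) =
      (balancedRel M).mkQ (c ⊗ₜ[k] m)
    rw [contract_rTensor, preCoact_counit]

theorem lin_smul {M N : RComod k C} (g : M ⟶ N) (f : DualAlg k C) (m : M.carrier) :
    lin g (f • m) = f • lin g m := by
  have h := LinearMap.congr_fun g.comm m
  simp only [LinearMap.comp_apply] at h
  rw [smul_def, smul_def, h, contract_rTensor]

theorem balancedRel_le_comap {M N : RComod k C} (g : M ⟶ N) :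
    balancedRel M ≤ (balancedRel N).comap ((lin g).lTensor C) := by
  refine Submodule.span_le.2 ?_
  rintro _ ⟨c, f, m, rfl⟩
  refine Submodule.subset_span ⟨c, f, lin g m, ?_⟩
  simp [lin_smul]

/-- The comodule morphism `C ⊗_{C*} M → C ⊗_{C*} N`, `c ⊗ m ↦ c ⊗ g(m)`. -/
noncomputable def balancedMap {M N : RComod k C} (g : M ⟶ N) :
    balancedTensor M ⟶ balancedTensor N :=
  (⟨(balancedRel M).mapQ (balancedRel N) ((lin g).lTensor C) (balancedRel_le_comap g), by
    refine (LinearMap.cancel_right (Submodule.mkQ_surjective (balancedRel M))).1 ?_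
    refine TensorProduct.ext' fun c m => ?_
    change (balancedRel N).mkQ.rTensor C (preCoact N.carrier (c ⊗ₜ[k] lin g m)) =
      ((balancedRel M).mapQ (balancedRel N) ((lin g).lTensor C)
        (balancedRel_le_comap g)).rTensor C
        ((balancedRel M).mkQ.rTensor C (preCoact M.carrier (c ⊗ₜ[k] m)))
    simp only [preCoact, LinearMap.comp_apply, LinearMap.rTensor_tmul, LinearEquiv.coe_coe]
    induction (Coalgebra.comul (R := k) (A := C) c) with
    | zero => simp
    | add x y hx hy => simp only [map_add, TensorProduct.add_tmul, hx, hy]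
    | tmul a b => simp⟩ : Hom (balancedTensor M) (balancedTensor N))

variable (k C) in
/-- The right exact Nakayama functor `M ↦ C ⊗_{C*} M`. -/
noncomputable def nakayamaR : RComod k C ⥤ RComod k C where
  obj M := balancedTensor M
  map g := balancedMap g
  map_id M := by
    apply hom_ext
    refine (LinearMap.cancel_right (Submodule.mkQ_surjective (balancedRel M))).1 ?_
    refine TensorProduct.ext' fun c m => ?_
    rfl
  map_comp {M _ _} f g := by
    apply hom_ext
    refine (LinearMap.cancel_right (Submodule.mkQ_surjective (balancedRel M))).1 ?_
    refine TensorProduct.ext' fun c m => ?_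
    rfl

/-! ### Subcomodules, socle, and the two subcategories -/

/-- A subcomodule of `M`: a subspace `N` whose coaction takes values in `N ⊗ C`. -/
def IsSubcomodule (M : RComod k C) (N : Submodule k M.carrier) : Prop :=
  ∀ m ∈ N, M.coact m ∈ LinearMap.range (N.subtype.rTensor C)

/-- A simple subcomodule: a nonzero subcomodule with no subcomodules except `0` and itself. -/
def IsSimpleSubcomodule (M : RComod k C) (N : Submodule k M.carrier) : Prop :=
  M.IsSubcomodule N ∧ N ≠ ⊥ ∧ ∀ L : Submodule k M.carrier, M.IsSubcomodule L → L ≤ N →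
    L = ⊥ ∨ L = N

/-- The socle of `M`: the sum of all simple subcomodules. -/
def socle (M : RComod k C) : Submodule k M.carrier :=
  sSup {N | M.IsSimpleSubcomodule N}

/-- The socle of `M` has finite length: the lengths of strictly increasing chains of subcomodules
of the socle are bounded. -/
def HasFiniteSocle (M : RComod k C) : Prop :=
  FiniteDimensionalOrder {L : Submodule k M.carrier // M.IsSubcomodule L ∧ L ≤ M.socle}

variable (k C) in
/-- Injective right comodules whose socle has finite length. -/
def injSF : ObjectProperty (RComod k C) := fun M => Injective M ∧ M.HasFiniteSocle

variable (k C) in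
/-- Finite-dimensional right comodules. -/
def finDim : ObjectProperty (RComod k C) := fun M => Module.Finite k M.carrier

variable (k C) in
/-- Projective objects of the category of finite-dimensional right comodules. -/
def projFD : ObjectProperty (RComod k C) :=
  fun M => ∃ h : finDim k C M, Projective (⟨M, h⟩ : (finDim k C).FullSubcategory)

end RComod

/-! ### Projective covers, injective hulls, restrictions of functors -/

/-- `π : P ⟶ X` is a projective cover: `P` is projective and `π` is an essential (superfluous)
epimorphism. -/
structure IsProjectiveCover {D : Type*} [Category D] {P X : D} (π : P ⟶ X) : Prop where
  projective : Projective P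
  epi : Epi π
  essential : ∀ {Y : D} (g : Y ⟶ P), Epi (g ≫ π) → Epi g

/-- `i : X ⟶ E` is an injective hull: `E` is injective and `i` is an essential monomorphism. -/
structure IsInjectiveHull {D : Type*} [Category D] {X E : D} (i : X ⟶ E) : Prop where
  injective : Injective E
  mono : Mono i
  essential : ∀ {Y : D} (g : E ⟶ Y), Mono (i ≫ g) → Mono g

/-- `C` is right semiperfect: every finite-dimensional right `C`-comodule has a projective cover
in the category of all right `C`-comodules. -/
def IsRightSemiperfect (k C : Type u) [Field k] [AddCommGroup C] [Module k C] [Coalgebra k C] :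
    Prop :=
  ∀ M : RComod k C, RComod.finDim k C M → ∃ (P : RComod k C) (π : P ⟶ M), IsProjectiveCover π

/-- The functor between the full subcategories on `A` and `B` induced by an endofunctor `F` that
maps `A` into `B`. -/
abbrev restrictFunctor {D : Type*} [Category D] (F : D ⥤ D) (A B : ObjectProperty D)
    (h : ∀ X, A X → B (F.obj X)) : A.FullSubcategory ⥤ B.FullSubcategory :=
  B.lift (A.ι ⋙ F) fun X => h X.obj X.property

/-- `F` restricts to an equivalence from `A` to `B`: it maps `A` into `B`, and the induced functor
is an equivalence of categories. -/
def RestrictsToEquivalence {D : Type*} [Category D] (F : D ⥤ D) (A B : ObjectProperty D) : Prop :=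
  ∃ h : ∀ X, A X → B (F.obj X), (restrictFunctor F A B h).IsEquivalence

/-!
The argument compares the two Nakayama functors `T = C ⊗_{C*} -` (`nakayamaR`) and
`H = Hom^C(C, -)^rat` (`nakayamaL`) through the adjunction `T ⊣ H`, whose unit is
`m ↦ (c ↦ c ⊗ m)` (`unitHom`) and whose counit is evaluation (`counitHom`).

The key point concerns a finite-dimensional comodule `P` that is projective among the
finite-dimensional comodules, with no hypothesis on `C`: such a `P` has a finite dual basis over
`C*` (`nonempty_dualBasis`), that is, it is a direct summand of `C* ^ n` as a `C*`-module. A section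
of `C* ^ n → P` is a solution of a system of linear equations in a full dual space, so by linear
compactness (`exists_dual_of_forall_finset`) it suffices to solve finite subsystems. These only
involve a finite-dimensional subspace `W` of `C` stable under `C*`, and the quotient of `C* ^ n`
dual to `W ^ n` is a finite-dimensional comodule, along which `P` lifts
(`exists_approx_section`).

The dual basis makes everything about `T P` explicit. The comodule `T P` is a direct summand of
`C ^ n`, hence injective; the unit `P → H (T P)` is an isomorphism; for every `M` there is a nonzero
morphism `M → T P` if and only if there is a nonzero morphism `P → M`; and the socle of `T P`
is finite-dimensional because the annihilator of `P` kills it. Hence `T` always maps projectives of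
the finite-dimensional category to injectives with finite socle.

Each of the three conditions is equivalent to `DetectedByProjFD`: every nonzero comodule receives a
nonzero morphism from some such `P`. For semiperfectness this is the usual passage between
projective covers and enough projectives. If `T` or `H` restricts to an equivalence, then the
injective hull `E` of a simple `S`, which exists by `exists_injectiveHull`, is isomorphic to some
`T P`, for `H` because the unit identifies `H E` with `H (T (H E))`; so `P` maps onto `S`.
Conversely, under `DetectedByProjFD` every injective comodule with finite socle is a direct
summand of some `T P` (`exists_retract_nakayamaR`), so that the unit and the counit are isomorphisms
on the two subcategories. Finally, for a simple `S`, the comodule `H (E(S))` is a nonzero direct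
summand of the indecomposable `P(S)`.
-/

namespace RComod

/-! ### Finiteness of contractions -/

variable {k C : Type u} [Field k] [AddCommGroup C] [Module k C]

/-- The contractions of one tensor in `V ⊗ C` span a finite-dimensional subspace of `V`. -/
theorem finite_range_contract (V : Type u) [AddCommGroup V] [Module k V] (t : V ⊗[k] C) :
    ∃ W : Submodule k V, W.FG ∧ ∀ f : C →ₗ[k] k, contract V f t ∈ W := by
  induction t with
  | zero => exact ⟨⊥, Submodule.fg_bot, fun f => by simp⟩
  | tmul v c =>
    exact ⟨k ∙ v, Submodule.fg_span_singleton v, fun f => by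
      rw [contract_tmul]
      exact Submodule.smul_mem _ _ (Submodule.mem_span_singleton_self v)⟩
  | add x y hx hy =>
    obtain ⟨W, hW, h⟩ := hx
    obtain ⟨W', hW', h'⟩ := hy
    exact ⟨W ⊔ W', hW.sup hW', fun f => by
      rw [map_add]
      exact Submodule.add_mem_sup (h f) (h' f)⟩

variable [Coalgebra k C]

/-! ### Comodules as rational modules over the dual algebra -/

/-- A linear map between comodules that commutes with the action of `C*` is a comodule morphism. -/
noncomputable def homOfSmul {M N : RComod k C} (φ : M.carrier →ₗ[k] N.carrier)
    (h : ∀ (f : DualAlg k C) (m : M.carrier), φ (f • m) = f • φ m) : M ⟶ N :=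
  (⟨φ, by
    ext1 m
    refine eq_of_contract fun f => ?_
    simp only [LinearMap.comp_apply]
    rw [contract_rTensor]
    exact (h (WithConv.toConv f) m).symm⟩ : Hom M N)

/-- A comodule morphism as a `C*`-linear map. -/
noncomputable def linStar {M N : RComod k C} (g : M ⟶ N) :
    M.carrier →ₗ[DualAlg k C] N.carrier where
  toFun := lin g
  map_add' := map_add (lin g)
  map_smul' := lin_smul g

/-- A `C*`-linear map between comodules as a comodule morphism. -/
noncomputable def homOfLinear {M N : RComod k C} (φ : M.carrier →ₗ[DualAlg k C] N.carrier) :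
    M ⟶ N :=
  homOfSmul (φ.restrictScalars k) fun f m => map_smul φ f m

@[simp] theorem lin_zero (M N : RComod k C) : lin (0 : M ⟶ N) = 0 := rfl

@[simp] theorem lin_add {M N : RComod k C} (f g : M ⟶ N) : lin (f + g) = lin f + lin g := rfl

theorem lin_sum {ι : Type*} (s : Finset ι) {M N : RComod k C} (f : ι → (M ⟶ N)) (m : M.carrier) :
    lin (∑ i ∈ s, f i) m = ∑ i ∈ s, lin (f i) m := by
  classical
  induction s using Finset.induction_on with
  | empty => simp
  | insert i s hi ih => simp [Finset.sum_insert hi, ih]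

theorem hom_ext_apply {M N : RComod k C} {f g : M ⟶ N} (h : ∀ m, lin f m = lin g m) : f = g :=
  hom_ext (LinearMap.ext h)

theorem comp_apply_eq {M N L : RComod k C} {f : M ⟶ N} {g : N ⟶ L} {h : M ⟶ L} (e : f ≫ g = h)
    (m : M.carrier) : lin g (lin f m) = lin h m := by
  rw [← e]; rfl

theorem isIso_of_bijective {M N : RComod k C} (f : M ⟶ N) (hf : Function.Bijective (lin f)) :
    IsIso f := by
  let e := LinearEquiv.ofBijective (linStar f) hf
  refine ⟨homOfLinear e.symm.toLinearMap, ?_, ?_⟩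
  · exact hom_ext_apply fun m => e.symm_apply_apply m
  · exact hom_ext_apply fun m => e.apply_symm_apply m

theorem bijective_of_isIso {M N : RComod k C} (f : M ⟶ N) [IsIso f] :
    Function.Bijective (lin f) :=
  Function.bijective_iff_has_inverse.2 ⟨lin (inv f),
    comp_apply_eq (IsIso.hom_inv_id f), comp_apply_eq (IsIso.inv_hom_id f)⟩

section rational

variable {V : Type u} [AddCommGroup V] [Module k V] [Module (DualAlg k C) V]
  [IsScalarTower k (DualAlg k C) V]

variable (k C V) in
/-- The inclusion of the rational part, as a `C*`-linear map. -/
noncomputable def ratIncl : (rat k C V).carrier →ₗ[DualAlg k C] V where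
  toFun := (ratPart k C V).subtype
  map_add' := map_add _
  map_smul' f v := contract_ratCoact k C v f

theorem ratIncl_injective : Function.Injective (ratIncl k C V) :=
  Subtype.val_injective

theorem exists_ratIncl_eq {v : V} (hv : v ∈ ratPart k C V) :
    ∃ x : (rat k C V).carrier, ratIncl k C V x = v := ⟨(⟨v, hv⟩ : ratPart k C V), rfl⟩

theorem mem_ratPart (M : RComod k C) (m : M.carrier) : m ∈ ratPart k C M.carrier :=
  ⟨M.coact m, fun _ => rfl⟩

/-- The morphism of comodules into the rational part of `V` given by a `C*`-linear map from a
comodule to `V`. -/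
noncomputable def toRat {M : RComod k C} (φ : M.carrier →ₗ[DualAlg k C] V) : M ⟶ rat k C V :=
  homOfSmul ((φ.restrictScalars k).codRestrict (ratPart k C V)
    fun m => map_mem_ratPart k C φ (mem_ratPart M m)) fun f m => ratIncl_injective <| by
      rw [map_smul]
      exact map_smul φ f m

/-- Rationality of a vector can be tested after any injective linear map. -/
theorem mem_ratPart_of_injective {V' : Type u} [AddCommGroup V'] [Module k V'] {φ : V →ₗ[k] V'}
    (hφ : Function.Injective φ) {v : V} (t : V' ⊗[k] C)
    (ht : ∀ f : DualAlg k C, φ (f • v) = contract V' f.ofConv t) : v ∈ ratPart k C V := by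
  obtain ⟨ψ, hψ⟩ := φ.exists_leftInverse_of_injective (LinearMap.ker_eq_bot.2 hφ)
  refine ⟨ψ.rTensor C t, fun f => ?_⟩
  rw [contract_rTensor, ← ht]
  exact (LinearMap.congr_fun hψ (f • v)).symm

/-- A vector `v` is rational as soon as finitely many functionals `χ` separate the points of the
module and each matrix coefficient `f ↦ χ (f • v)` is the evaluation at an element of `C`. -/
theorem mem_ratPart_of_functionals {κ : Type} [Fintype κ] (χ : κ → V →ₗ[k] k)
    (hχ : ∀ v, (∀ j, χ j v = 0) → v = 0) {v : V}
    (h : ∀ j, ∃ c : C, ∀ f : DualAlg k C, χ j (f • v) = f.ofConv c) : v ∈ ratPart k C V := by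
  classical
  choose c hc using h
  refine mem_ratPart_of_injective (V' := κ → k) (φ := LinearMap.pi χ)
    ((injective_iff_map_eq_zero _).2 fun v hv => hχ v fun j => congrFun hv j)
    (∑ j, Pi.single j (1 : k) ⊗ₜ[k] c j) fun f => ?_
  ext j
  simp [hc, Finset.sum_apply, Pi.single_apply]

end rational

/-! ### Subobjects, quotients, monomorphisms and epimorphisms -/

section sub

variable {M : RComod k C}

/-- The comodule structure on a `C*`-submodule of a comodule. -/
noncomputable def sub (K : Submodule (DualAlg k C) M.carrier) : RComod k C := rat k C K

/-- The inclusion of a subcomodule. -/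
noncomputable def subHom (K : Submodule (DualAlg k C) M.carrier) : sub K ⟶ M :=
  homOfLinear (K.subtype ∘ₗ ratIncl k C K)

theorem subHom_injective (K : Submodule (DualAlg k C) M.carrier) :
    Function.Injective (lin (subHom K)) :=
  K.injective_subtype.comp ratIncl_injective

theorem subHom_mem (K : Submodule (DualAlg k C) M.carrier) (x : (sub K).carrier) :
    lin (subHom K) x ∈ K :=
  (ratIncl k C K x).2

theorem exists_subHom_eq (K : Submodule (DualAlg k C) M.carrier) {m : M.carrier} (hm : m ∈ K) :
    ∃ x, lin (subHom K) x = m := by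
  have h : (⟨m, hm⟩ : K) ∈ ratPart k C K :=
    mem_ratPart_of_injective (φ := K.subtype.restrictScalars k) K.injective_subtype
      (M.coact m) fun f => rfl
  obtain ⟨x, hx⟩ := exists_ratIncl_eq h
  exact ⟨x, congrArg Subtype.val hx⟩

/-- The corestriction of a morphism to a subcomodule containing its range. -/
noncomputable def subLift {N : RComod k C} (K : Submodule (DualAlg k C) M.carrier) (g : N ⟶ M)
    (h : ∀ n, lin g n ∈ K) : N ⟶ sub K :=
  toRat ((linStar g).codRestrict K h)

/-- The comodule structure on the quotient of a comodule by a `C*`-submodule. -/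
noncomputable def quot (K : Submodule (DualAlg k C) M.carrier) : RComod k C :=
  rat k C (M.carrier ⧸ K)

/-- The projection onto a quotient comodule. -/
noncomputable def quotHom (K : Submodule (DualAlg k C) M.carrier) : M ⟶ quot K := toRat K.mkQ

theorem quotHom_surjective (K : Submodule (DualAlg k C) M.carrier) :
    Function.Surjective (lin (quotHom K)) := by
  intro y
  obtain ⟨m, hm⟩ := K.mkQ_surjective (ratIncl k C (M.carrier ⧸ K) y)
  exact ⟨m, ratIncl_injective hm⟩

theorem quotHom_eq_zero (K : Submodule (DualAlg k C) M.carrier) (m : M.carrier) :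
    lin (quotHom K) m = 0 ↔ m ∈ K := by
  rw [← Submodule.Quotient.mk_eq_zero K]
  refine ⟨fun h => ?_, fun h => ratIncl_injective h⟩
  have := congrArg (ratIncl k C (M.carrier ⧸ K)) h
  exact this

end sub

theorem mono_of_injective {M N : RComod k C} {f : M ⟶ N} (hf : Function.Injective (lin f)) :
    Mono f :=
  ⟨fun _ _ h => hom_ext_apply fun m => hf (LinearMap.congr_fun (congrArg lin h) m)⟩

theorem epi_of_surjective {M N : RComod k C} {f : M ⟶ N} (hf : Function.Surjective (lin f)) :
    Epi f :=
  ⟨fun a b h => hom_ext_apply fun n => by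
    obtain ⟨m, rfl⟩ := hf n
    exact LinearMap.congr_fun (congrArg lin h) m⟩

theorem injective_of_mono {M N : RComod k C} (f : M ⟶ N) [Mono f] :
    Function.Injective (lin f) := by
  refine (injective_iff_map_eq_zero _).2 fun m hm => ?_
  obtain ⟨x, rfl⟩ := exists_subHom_eq (LinearMap.ker (linStar f)) hm
  have h : subHom (LinearMap.ker (linStar f)) = 0 := by
    rw [← cancel_mono f]
    exact hom_ext_apply fun x => (subHom_mem (LinearMap.ker (linStar f)) x).trans (by simp)
  rw [h]
  rfl

/-- Surjectivity is tested on quotients of the target only, so the criterion also applies inside the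
category of finite-dimensional comodules. -/
theorem surjective_of_comp_eq_zero {M N : RComod k C} (f : M ⟶ N)
    (h : ∀ (K : Submodule (DualAlg k C) N.carrier), f ≫ quotHom K = 0 → quotHom K = 0) :
    Function.Surjective (lin f) := by
  have h0 := h (LinearMap.range (linStar f))
    (hom_ext_apply fun m => (quotHom_eq_zero _ _).2 ⟨m, rfl⟩)
  intro n
  have : n ∈ LinearMap.range (linStar f) := (quotHom_eq_zero _ n).1 (by rw [h0]; rfl)
  exact this

theorem surjective_of_epi {M N : RComod k C} (f : M ⟶ N) [Epi f] :
    Function.Surjective (lin f) :=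
  surjective_of_comp_eq_zero f fun K h => by rw [← cancel_epi f, h, Limits.comp_zero]

/-- The `C*`-submodules of a comodule are its subcomodules. -/
theorem isSubcomodule_iff (M : RComod k C) (N : Submodule k M.carrier) :
    M.IsSubcomodule N ↔ ∃ K : Submodule (DualAlg k C) M.carrier, K.restrictScalars k = N := by
  constructor
  · intro h
    refine ⟨{ N with smul_mem' := fun f m hm => ?_ }, rfl⟩
    obtain ⟨t, ht⟩ := h m hm
    change f • m ∈ N
    rw [smul_def, ← ht, contract_rTensor]
    exact Submodule.coe_mem _
  · rintro ⟨K, rfl⟩ m hm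
    obtain ⟨x, rfl⟩ := exists_subHom_eq K hm
    refine ⟨((lin (subHom K)).codRestrict (K.restrictScalars k) fun x => subHom_mem K x).rTensor C
      ((sub K).coact x), ?_⟩
    have h := LinearMap.congr_fun (subHom K).comm x
    simp only [LinearMap.comp_apply] at h
    rw [← LinearMap.comp_apply, ← LinearMap.rTensor_comp]
    exact h.symm

/-! ### Local finiteness -/

theorem finite_of_injective {M N : RComod k C} (f : M ⟶ N) (hf : Function.Injective (lin f))
    (hN : finDim k C N) : finDim k C M :=
  have : Module.Finite k N.carrier := hN
  Module.Finite.of_injective (lin f) hf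

theorem finite_of_surjective {M N : RComod k C} (f : M ⟶ N) (hf : Function.Surjective (lin f))
    (hM : finDim k C M) : finDim k C N :=
  have : Module.Finite k M.carrier := hM
  Module.Finite.of_surjective (lin f) hf

/-- The subcomodule generated by one element is finite-dimensional. -/
theorem exists_finDim_sub (M : RComod k C) (m : M.carrier) :
    ∃ K : Submodule (DualAlg k C) M.carrier, m ∈ K ∧ finDim k C (sub K) := by
  obtain ⟨W, hW, h⟩ := finite_range_contract M.carrier (M.coact m)
  refine ⟨DualAlg k C ∙ m, Submodule.mem_span_singleton_self m, ?_⟩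
  have : Module.Finite k W := Module.Finite.of_fg hW
  refine Module.Finite.of_injective ((lin (subHom (DualAlg k C ∙ m))).codRestrict W fun x => ?_)
    fun x y hxy => subHom_injective _ <| by
      have h := congrArg (Submodule.subtype _) hxy
      exact h
  obtain ⟨f, hf⟩ := Submodule.mem_span_singleton.1 (subHom_mem _ x)
  rw [← hf]
  exact h f.ofConv

theorem finDim_sub_sup {M : RComod k C} {K L : Submodule (DualAlg k C) M.carrier}
    (hK : finDim k C (sub K)) (hL : finDim k C (sub L)) : finDim k C (sub (K ⊔ L)) := by
  have : Module.Finite k (sub K).carrier := hK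
  have : Module.Finite k (sub L).carrier := hL
  let φ : (sub K).carrier × (sub L).carrier →ₗ[k] M.carrier :=
    (lin (subHom K)).coprod (lin (subHom L))
  refine Module.Finite.of_injective ((lin (subHom (K ⊔ L))).codRestrict (LinearMap.range φ)
    fun x => ?_) fun x y hxy => subHom_injective _ <| by
      have h := congrArg (Submodule.subtype _) hxy
      exact h
  obtain ⟨y, hy, z, hz, h⟩ := Submodule.mem_sup.1 (subHom_mem (K ⊔ L) x)
  obtain ⟨y, rfl⟩ := exists_subHom_eq K hy
  obtain ⟨z, rfl⟩ := exists_subHom_eq L hz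
  exact ⟨(y, z), h⟩

theorem finDim_sub_of_le {M : RComod k C} {K L : Submodule (DualAlg k C) M.carrier}
    (hL : finDim k C (sub L)) (h : K ≤ L) : finDim k C (sub K) :=
  finite_of_injective (subLift L (subHom K) fun x => h (subHom_mem K x))
    (fun _ _ hxy => subHom_injective K (congrArg (lin (subHom L)) hxy)) hL

/-- Finitely many elements of a comodule lie in a finite-dimensional subcomodule. -/
theorem exists_finDim_sub_of_finset (M : RComod k C) (s : Finset M.carrier) :
    ∃ K : Submodule (DualAlg k C) M.carrier, (∀ m ∈ s, m ∈ K) ∧ finDim k C (sub K) := by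
  classical
  induction s using Finset.induction_on with
  | empty =>
    obtain ⟨K, -, hK⟩ := exists_finDim_sub M 0
    exact ⟨K, by simp, hK⟩
  | insert m s hm ih =>
    obtain ⟨K, hK, hK'⟩ := ih
    obtain ⟨L, hL, hL'⟩ := exists_finDim_sub M m
    refine ⟨K ⊔ L, fun x hx => ?_, finDim_sub_sup hK' hL'⟩
    rcases Finset.mem_insert.1 hx with rfl | hx
    · exact Submodule.mem_sup_right hL
    · exact Submodule.mem_sup_left (hK x hx)

/-! ### The regular comodule and matrix coefficients -/

theorem eq_of_dual {V : Type u} [AddCommGroup V] [Module k V] {v w : V}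
    (h : ∀ f : V →ₗ[k] k, f v = f w) : v = w :=
  sub_eq_zero.1 ((Module.forall_dual_apply_eq_zero_iff k _).1 fun f => by
    rw [map_sub, h, sub_self])

variable (k C) in
/-- The coalgebra `C` as a right comodule over itself. -/
noncomputable def regular : RComod k C where
  carrier := C
  coact := Coalgebra.comul
  coassoc := Coalgebra.coassoc
  counit_coact := by
    ext c
    simp [Coalgebra.lTensor_counit_comul]

variable (k C) in
/-- The counit of `C` as a functional on the regular comodule. -/
noncomputable def regularCounit : (regular k C).carrier →ₗ[k] k :=
  Coalgebra.counit (R := k) (A := C)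

theorem regularCounit_smul (f : DualAlg k C) (c : (regular k C).carrier) :
    regularCounit k C (f • c) = f.ofConv c := by
  have h : ∀ t : C ⊗[k] C, Coalgebra.counit (R := k) (contract C f.ofConv t) =
      contract k f.ofConv ((Coalgebra.counit (R := k) (A := C)).rTensor C t) := fun t =>
    (contract_rTensor _ _ _).symm
  refine (h _).trans ((congrArg (contract k f.ofConv)
    (Coalgebra.rTensor_counit_comul (R := k) (A := C) (c : C))).trans ?_)
  exact (contract_tmul f.ofConv (1 : k) (c : C)).trans (mul_one _)

theorem counit_hitRight (f : DualAlg k C) (c : C) :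
    Coalgebra.counit (R := k) (hitRight f c) = f.ofConv c := by
  have h : ∀ t : C ⊗[k] C, Coalgebra.counit (R := k) (TensorProduct.lid k C (f.ofConv.rTensor C t))
      = f.ofConv (TensorProduct.rid k C
        ((Coalgebra.counit (R := k) (A := C)).lTensor C t)) := by
    intro t
    induction t with
    | zero => simp
    | add x y hx hy => simp only [map_add, hx, hy]
    | tmul a b => simp [mul_comm]
  refine (h _).trans ?_
  rw [Coalgebra.lTensor_counit_comul]
  simp

/-- A comodule morphism to `C` is determined by its composition with the counit. -/
theorem hom_regular_ext {M : RComod k C} {g h : M ⟶ regular k C}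
    (e : ∀ m, regularCounit k C (lin g m) = regularCounit k C (lin h m)) : g = h :=
  hom_ext_apply fun m => eq_of_dual fun (f : C →ₗ[k] k) => by
    have h1 := e (WithConv.toConv f • m)
    rw [lin_smul, lin_smul, regularCounit_smul, regularCounit_smul] at h1
    exact h1

/-- The morphism `m ↦ ⟨ξ, m₍₀₎⟩ m₍₁₎` to the regular comodule given by a functional `ξ`. -/
noncomputable def coeff {M : RComod k C} (ξ : M.carrier →ₗ[k] k) : M ⟶ regular k C :=
  have key : ∀ (f : DualAlg k C) (m : M.carrier),
      f.ofConv (TensorProduct.lid k C (ξ.rTensor C (M.coact m))) = ξ (f • m) := by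
    intro f m
    rw [smul_def]
    induction M.coact m with
    | zero => simp
    | add x y hx hy => simp only [map_add, hx, hy]
    | tmul a b => simp [mul_comm]
  homOfSmul (N := regular k C)
    ((TensorProduct.lid k C).toLinearMap ∘ₗ ξ.rTensor C ∘ₗ M.coact) fun f m => by
      refine eq_of_dual fun (g : C →ₗ[k] k) => ?_
      refine (key (WithConv.toConv g) (f • m)).trans ?_
      rw [← mul_smul, ← key]
      refine (regularCounit_smul _ _).symm.trans ?_
      exact (congrArg (regularCounit k C) (mul_smul (WithConv.toConv g) f _)).trans
        (regularCounit_smul _ _)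

theorem apply_coeff {M : RComod k C} (ξ : M.carrier →ₗ[k] k) (f : DualAlg k C) (m : M.carrier) :
    f.ofConv (lin (coeff ξ) m) = ξ (f • m) := by
  rw [smul_def]
  change f.ofConv (TensorProduct.lid k C (ξ.rTensor C (M.coact m))) = _
  induction M.coact m with
  | zero => simp
  | add x y hx hy => simp only [map_add, hx, hy]
  | tmul a b => simp [mul_comm]

theorem regularCounit_coeff {M : RComod k C} (ξ : M.carrier →ₗ[k] k) (m : M.carrier) :
    regularCounit k C (lin (coeff ξ) m) = ξ m := by
  have h := apply_coeff ξ 1 m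
  rw [one_smul, ← regularCounit_smul, one_smul] at h
  exact h

/-- The endomorphism `c ↦ c ↼ f` of the regular comodule. -/
noncomputable def hitRightHom (f : DualAlg k C) : regular k C ⟶ regular k C :=
  ({ toLin := hitRight (k := k) (C := C) f, comm := comul_hitRight f } :
    Hom (regular k C) (regular k C))

theorem regularCounit_hitRightHom (f : DualAlg k C) (c : (regular k C).carrier) :
    regularCounit k C (lin (hitRightHom f) c) = f.ofConv c :=
  counit_hitRight f c

theorem mul_apply_eq_hitRight (f g : DualAlg k C) (c : C) :
    (f * g).ofConv c = g.ofConv (hitRight f c) := by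
  rw [← counit_hitRight, hitRight_mul, LinearMap.comp_apply, counit_hitRight]

theorem mul_apply_eq_smul (f g : DualAlg k C) (c : (regular k C).carrier) :
    (f * g).ofConv c = f.ofConv (g • c : (regular k C).carrier) := by
  rw [← regularCounit_smul, mul_smul, regularCounit_smul]

/-- The regular comodule is injective: morphisms to it are functionals, and functionals extend. -/
theorem exists_extend_regular {U V : RComod k C} (j : U ⟶ V) (hj : Function.Injective (lin j))
    (g : U ⟶ regular k C) : ∃ h : V ⟶ regular k C, j ≫ h = g := by
  obtain ⟨r, hr⟩ := (lin j).exists_leftInverse_of_injective (LinearMap.ker_eq_bot.2 hj)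
  refine ⟨coeff (regularCounit k C ∘ₗ lin g ∘ₗ r), hom_regular_ext fun m => ?_⟩
  refine (regularCounit_coeff _ _).trans ?_
  exact congrArg (fun x => regularCounit k C (lin g x)) (LinearMap.congr_fun hr m)

theorem injective_regular : Injective (regular k C) :=
  ⟨fun g j _ => exists_extend_regular j (injective_of_mono j) g⟩

/-! ### Projective objects among the finite-dimensional comodules -/

/-- Projectivity in the category of finite-dimensional comodules, as a lifting property: the
epimorphisms of that category are the surjective morphisms. -/
theorem projFD_iff (P : RComod k C) :
    projFD k C P ↔ finDim k C P ∧ ∀ (M N : RComod k C) (e : M ⟶ N) (g : P ⟶ N),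
      finDim k C M → finDim k C N → Function.Surjective (lin e) → ∃ h : P ⟶ M, h ≫ e = g := by
  constructor
  · rintro ⟨hP, hproj⟩
    refine ⟨hP, fun M N e g hM hN he => ?_⟩
    let M' : (finDim k C).FullSubcategory := ⟨M, hM⟩
    let N' : (finDim k C).FullSubcategory := ⟨N, hN⟩
    let e' : M' ⟶ N' := ObjectProperty.homMk e
    have : Epi e' := ⟨fun a b h => by
      have := epi_of_surjective he
      refine ObjectProperty.hom_ext _ ?_
      rw [← cancel_epi e]
      exact congrArg (fun f => f.hom) h⟩
    obtain ⟨h, hh⟩ := Projective.factors (P := (⟨P, hP⟩ : (finDim k C).FullSubcategory))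
      (ObjectProperty.homMk g : _ ⟶ N') e'
    exact ⟨h.hom, congrArg (fun f => f.hom) hh⟩
  · rintro ⟨hP, h⟩
    refine ⟨hP, ⟨fun {M N} g e he => ?_⟩⟩
    have hsurj : Function.Surjective (lin e.hom) := by
      refine surjective_of_comp_eq_zero e.hom fun K hK => ?_
      let Q : (finDim k C).FullSubcategory :=
        ⟨quot K, finite_of_surjective (quotHom K) (quotHom_surjective K) N.property⟩
      have h0 : (ObjectProperty.homMk (quotHom K) : N ⟶ Q) = ObjectProperty.homMk 0 := by
        rw [← cancel_epi e]
        refine ObjectProperty.hom_ext _ ?_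
        change e.hom ≫ quotHom K = e.hom ≫ 0
        rw [hK, Limits.comp_zero]
      exact congrArg (fun f => f.hom) h0
    obtain ⟨l, hl⟩ := h M.obj N.obj e.hom g.hom M.property N.property hsurj
    exact ⟨ObjectProperty.homMk l, ObjectProperty.hom_ext _ hl⟩

/-- Linear compactness: a system of linear equations in the unknown functional `l` on a vector
space is solvable if each of its finite subsystems is. -/
theorem exists_dual_of_forall_finset {ι W : Type*} [AddCommGroup W] [Module k W] (w : ι → W)
    (a : ι → k) (h : ∀ s : Finset ι, ∃ l : W →ₗ[k] k, ∀ i ∈ s, l (w i) = a i) :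
    ∃ l : W →ₗ[k] k, ∀ i, l (w i) = a i := by
  have hmem : Finsupp.linearCombination k a ∈
      LinearMap.range (Finsupp.linearCombination k w).dualMap := by
    rw [LinearMap.range_dualMap_eq_dualAnnihilator_ker, Submodule.mem_dualAnnihilator]
    intro x hx
    obtain ⟨l, hl⟩ := h x.support
    have h1 := congrArg l (LinearMap.mem_ker.1 hx)
    rw [Finsupp.linearCombination_apply, Finsupp.sum, map_sum, map_zero] at h1
    rw [Finsupp.linearCombination_apply, Finsupp.sum, ← h1]
    exact Finset.sum_congr rfl fun i hi => by rw [map_smul, hl i hi]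
  obtain ⟨l, hl⟩ := hmem
  refine ⟨l, fun i => ?_⟩
  have := LinearMap.congr_fun hl (Finsupp.single i 1)
  simpa using this

/-- Every finite subset of `C` lies in a finite-dimensional subspace stable under the right
action of `C*`. -/
theorem exists_finite_hitRight_stable (s : Set C) (hs : s.Finite) :
    ∃ W : Submodule k C, Module.Finite k W ∧ s ⊆ W ∧
      ∀ (f : DualAlg k C), ∀ c ∈ W, hitRight f c ∈ W := by
  let W : Submodule k C := Submodule.span k {d | ∃ c ∈ s, ∃ f : DualAlg k C, d = hitRight f c}
  refine ⟨W, ?_, fun c hc => ?_, fun f c hc => ?_⟩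
  · have key : ∀ (f : DualAlg k C) (t : C ⊗[k] C), TensorProduct.lid k C (f.ofConv.rTensor C t) =
        contract C f.ofConv (TensorProduct.comm k C C t) := by
      intro f t
      induction t with
      | zero => simp
      | add x y hx hy => simp only [map_add, hx, hy]
      | tmul a b => simp
    choose U hU hU' using fun c : C => finite_range_contract C
      (TensorProduct.comm k C C (Coalgebra.comul (R := k) c))
    have hfg : (hs.toFinset.sup U).FG := Submodule.fg_finset_sup _ _ fun c _ => hU c
    have : Module.Finite k (hs.toFinset.sup U : Submodule k C) := Module.Finite.of_fg hfg
    refine Submodule.finiteDimensional_of_le (S₂ := hs.toFinset.sup U) (Submodule.span_le.2 ?_)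
    rintro _ ⟨c, hc, f, rfl⟩
    refine (Finset.le_sup (f := U) (hs.mem_toFinset.2 hc)) ?_
    have : hitRight f c = TensorProduct.lid k C (f.ofConv.rTensor C (Coalgebra.comul c)) := rfl
    rw [this, key]
    exact hU' c f.ofConv
  · refine Submodule.subset_span ⟨c, hc, 1, ?_⟩
    refine eq_of_dual (k := k) fun g => ?_
    have h := mul_apply_eq_hitRight 1 (WithConv.toConv g) c
    rw [one_mul] at h
    exact h
  · have : W ≤ W.comap (hitRight f) := Submodule.span_le.2 <| by
      rintro _ ⟨c, hc, g, rfl⟩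
      refine Submodule.subset_span ⟨c, hc, g * f, ?_⟩
      rw [hitRight_mul]
      rfl
    exact this hc

section dualBasis

variable {P : RComod k C} {n : ℕ}

/-- For a finite-dimensional subspace `W` of `C` that is stable under `C*` and contains the matrix
coefficients of `P`, the free module `C* ^ n` modulo the functionals vanishing on `W` is a
finite-dimensional comodule with a surjection onto `P`. A section of this surjection, lifted to a
`k`-linear map to `C* ^ n`, is a section of `C* ^ n → P` that is `C*`-linear up to functionals
vanishing on `W`. -/
theorem exists_approx_section (hP : projFD k C P) (b : Module.Basis (Fin n) k P.carrier)
    (W : Submodule k C) [Module.Finite k W] (hW : ∀ (f : DualAlg k C), ∀ c ∈ W, hitRight f c ∈ W)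
    (hb : ∀ i j, lin (coeff (b.coord i)) (b j) ∈ W) :
    ∃ B : P.carrier →ₗ[k] (Fin n → DualAlg k C), (∀ x, ∑ j, B x j • b j = x) ∧
      ∀ (f : DualAlg k C) (x : P.carrier) (i : Fin n), ∀ c ∈ W,
        (B (f • x) i).ofConv c = (B x i).ofConv (hitRight f c) := by
  let K : Submodule (DualAlg k C) (Fin n → DualAlg k C) :=
    { carrier := {φ | ∀ i, ∀ c ∈ W, (φ i).ofConv c = 0}
      zero_mem' := fun i c _ => by simp
      add_mem' := fun {φ ψ} hφ hψ i c hc => by simp [hφ i c hc, hψ i c hc]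
      smul_mem' := fun f φ hφ i c hc => by
        rw [Pi.smul_apply, smul_eq_mul, mul_apply_eq_hitRight]
        exact hφ i _ (hW f c hc) }
  let F := (Fin n → DualAlg k C) ⧸ K
  obtain ⟨σ, hσ⟩ := (K.mkQ.restrictScalars k).exists_rightInverse_of_surjective
    (LinearMap.range_eq_top.2 K.mkQ_surjective)
  have hσ' : ∀ v : F, K.mkQ (σ v) = v := fun v => LinearMap.congr_fun hσ v
  have hσf : ∀ (f : DualAlg k C) (v : F) (i : Fin n), ∀ c ∈ W,
      (σ (f • v) i).ofConv c = (σ v i).ofConv (hitRight f c) := by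
    intro f v i c hc
    have h : σ (f • v) - f • σ v ∈ K := by
      rw [← Submodule.Quotient.eq]
      refine (hσ' (f • v)).trans ?_
      rw [Submodule.Quotient.mk_smul]
      exact congrArg (f • ·) (hσ' v).symm
    have h1 := h i c hc
    rw [Pi.sub_apply, WithConv.ofConv_sub, LinearMap.sub_apply, sub_eq_zero, Pi.smul_apply,
      smul_eq_mul, mul_apply_eq_hitRight] at h1
    exact h1
  let w := Module.finBasis k W
  let χ : Fin n × Fin (Module.finrank k W) → F →ₗ[k] k := fun q =>
    { toFun := fun v => (σ v q.1).ofConv (w q.2)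
      map_add' := fun u v => by simp
      map_smul' := fun a v => by simp }
  have hχ : ∀ v, (∀ q, χ q v = 0) → v = 0 := by
    intro v hv
    rw [← hσ' v]
    refine (Submodule.Quotient.mk_eq_zero K).2 fun i c hc => ?_
    have h0 : (σ v i).ofConv ∘ₗ W.subtype = 0 := w.ext fun l => hv (i, l)
    exact LinearMap.congr_fun h0 ⟨c, hc⟩
  have hrat : ∀ v : F, v ∈ ratPart k C F := fun v =>
    mem_ratPart_of_functionals χ hχ fun q =>
      ⟨σ v q.1 • (show (regular k C).carrier from (w q.2 : C)), fun f => by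
        rw [← mul_apply_eq_smul, mul_apply_eq_hitRight]
        exact hσf f v q.1 _ (w q.2).2⟩
  let π : (Fin n → DualAlg k C) →ₗ[DualAlg k C] P.carrier :=
    Fintype.linearCombination (DualAlg k C) b
  have hπ : ∀ φ, π φ = ∑ j, φ j • b j := fun φ => Fintype.linearCombination_apply _ _ _
  have hπK : K ≤ LinearMap.ker π := by
    intro φ hφ
    rw [LinearMap.mem_ker, hπ]
    refine b.ext_elem fun i => ?_
    rw [map_sum, map_zero, Finsupp.finsetSum_apply, Finsupp.zero_apply]
    refine Finset.sum_eq_zero fun j _ => ?_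
    exact (apply_coeff (b.coord i) (φ j) (b j)).symm.trans (hφ j _ (hb i j))
  let e : rat k C F ⟶ P := homOfLinear (K.liftQ π hπK ∘ₗ ratIncl k C F)
  have he : Function.Surjective (lin e) := by
    intro x
    obtain ⟨y, hy⟩ := exists_ratIncl_eq (hrat (K.mkQ fun j => algebraMap k _ (b.repr x j)))
    refine ⟨y, ?_⟩
    change K.liftQ π hπK (ratIncl k C F y) = x
    rw [hy, Submodule.mkQ_apply, Submodule.liftQ_apply, hπ]
    simp_rw [algebraMap_smul]
    exact b.sum_repr x
  have hfin : finDim k C (rat k C F) := by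
    refine Module.Finite.of_injective (LinearMap.pi χ ∘ₗ (ratIncl k C F).restrictScalars k) ?_
    exact (injective_iff_map_eq_zero _).2 fun v hv => ratIncl_injective
      ((hχ _ fun j => congrFun hv j).trans (map_zero _).symm)
  obtain ⟨hPfin, hlift⟩ := (projFD_iff P).1 hP
  obtain ⟨s, hs⟩ := hlift _ _ e (𝟙 P) hfin hPfin he
  refine ⟨σ ∘ₗ (ratIncl k C F).restrictScalars k ∘ₗ lin s, fun x => ?_, fun f x i c hc => ?_⟩
  · rw [← hπ]
    have h1 := comp_apply_eq hs x
    change K.liftQ π hπK (ratIncl k C F (lin s x)) = x at h1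
    rw [← hσ' (ratIncl k C F (lin s x))] at h1
    exact h1
  · have : ratIncl k C F (lin s (f • x)) = f • ratIncl k C F (lin s x) := by
      rw [lin_smul, map_smul]
    change (σ (ratIncl k C F (lin s (f • x))) i).ofConv c = _
    rw [this]
    exact hσf f _ i c hc

/-- A finite dual basis of a comodule `P` over `C*`: elements `elem i` of `P` and `C*`-linear
coordinates `coord i : P → C*` with `x = ∑ coord i x • elem i`. It exhibits `P` as a direct summand
of the `C*`-module `C* ^ n`. -/
structure DualBasis (P : RComod k C) where
  /-- the number of elements -/
  card : ℕ
  /-- the generating elements -/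
  elem : Fin card → P.carrier
  /-- the coordinates -/
  coord : Fin card → P.carrier →ₗ[DualAlg k C] DualAlg k C
  sum_coord_smul : ∀ x, ∑ i, coord i x • elem i = x

/-- A finite-dimensional comodule that is projective among the finite-dimensional ones has a
finite dual basis over `C*`, so it is a projective `C*`-module. -/
theorem nonempty_dualBasis (hP : projFD k C P) : Nonempty (DualBasis P) := by
  classical
  have : Module.Finite k P.carrier := hP.1
  let n := Module.finrank k P.carrier
  let b : Module.Basis (Fin n) k P.carrier := Module.finBasis k P.carrier
  -- The unknown `l` encodes a linear map `P → C* ^ n`; the equations say that it is `C*`-linear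
  -- and a section of `C* ^ n → P`.
  let w : (Fin n × P.carrier × DualAlg k C × C) ⊕ (P.carrier × Fin n) →
      (Fin n → P.carrier ⊗[k] C) := Sum.elim
    (fun q => Pi.single q.1 ((q.2.2.1 • q.2.1) ⊗ₜ[k] q.2.2.2 -
      q.2.1 ⊗ₜ[k] hitRight q.2.2.1 q.2.2.2))
    (fun q j => q.1 ⊗ₜ[k] (lin (coeff (b.coord q.2)) (b j) : C))
  obtain ⟨l, hl⟩ := exists_dual_of_forall_finset (k := k) w
    (Sum.elim (fun _ => 0) fun q => b.coord q.2 q.1) fun S => by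
    obtain ⟨W, hWfin, hSW, hW⟩ := exists_finite_hitRight_stable (k := k) (C := C)
      ((S.image fun q => Sum.elim (fun q => q.2.2.2) (fun _ => 0) q : Finset C) ∪
        Set.range fun q : Fin n × Fin n => (lin (coeff (b.coord q.1)) (b q.2) : C))
      ((Finset.finite_toSet _).union (Set.finite_range _))
    obtain ⟨B, hB, hB'⟩ := exists_approx_section hP b W hW
      fun i j => hSW (Or.inr ⟨(i, j), rfl⟩)
    let β : Fin n → P.carrier →ₗ[k] C →ₗ[k] k := fun j =>
      (WithConv.linearEquiv k (C →ₗ[k] k)).toLinearMap ∘ₗ LinearMap.proj j ∘ₗ B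
    have hβ : ∀ j x c, TensorProduct.lift (β j) (x ⊗ₜ[k] c) = (B x j).ofConv c := fun j x c => rfl
    refine ⟨∑ j, TensorProduct.lift (β j) ∘ₗ LinearMap.proj j, ?_⟩
    rintro (⟨i, x, f, c⟩ | ⟨x, i⟩) hq
    · have hc : c ∈ W := hSW (Or.inl (Finset.mem_coe.2 (Finset.mem_image.2 ⟨_, hq, rfl⟩)))
      simp only [w, Sum.elim_inl, LinearMap.sum_apply, LinearMap.comp_apply, LinearMap.proj_apply]
      rw [Finset.sum_eq_single i]
      · rw [Pi.single_eq_same, map_sub, hβ, hβ, hB' f x i c hc, sub_self]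
      · intro j _ hj
        rw [Pi.single_eq_of_ne hj, map_zero]
      · exact fun h => absurd (Finset.mem_univ i) h
    · simp only [w, Sum.elim_inr, LinearMap.sum_apply, LinearMap.comp_apply, LinearMap.proj_apply]
      conv_rhs => rw [← hB x]
      rw [map_sum]
      exact Finset.sum_congr rfl fun j _ => apply_coeff (b.coord i) (B x j) (b j)
  have hl1 : ∀ i x (f : DualAlg k C) c, l (Pi.single i ((f • x) ⊗ₜ[k] c)) =
      l (Pi.single i (x ⊗ₜ[k] hitRight f c)) := by
    intro i x f c
    have := hl (Sum.inl (i, x, f, c))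
    simp only [w, Sum.elim_inl, Pi.single_sub, map_sub, sub_eq_zero] at this
    exact this
  let B : Fin n → P.carrier →ₗ[k] C →ₗ[k] k := fun i =>
    TensorProduct.curry (l ∘ₗ LinearMap.single k (fun _ => P.carrier ⊗[k] C) i)
  have hB : ∀ i x c, B i x c = l (Pi.single i (x ⊗ₜ[k] c)) := fun i x c => rfl
  refine ⟨⟨n, b, fun i =>
    { toFun := fun x => WithConv.toConv (B i x)
      map_add' := fun x y => by rw [map_add]; rfl
      map_smul' := fun f x => by
        ext c
        rw [RingHom.id_apply, smul_eq_mul, mul_apply_eq_hitRight]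
        exact hl1 i x f c }, fun x => b.ext_elem fun i => ?_⟩⟩
  have h2 := hl (Sum.inr (x, i))
  simp only [w, Sum.elim_inr] at h2
  rw [map_sum, Finsupp.finsetSum_apply]
  refine Eq.trans ?_ h2
  rw [← LinearMap.sum_single_apply (fun _ => P.carrier ⊗[k] C)
    (fun j => x ⊗ₜ[k] (lin (coeff (b.coord i)) (b j) : C)), map_sum]
  refine Finset.sum_congr rfl fun j _ => ?_
  exact (apply_coeff (b.coord i) _ (b j)).symm

end dualBasis

/-! ### The balanced tensor product with a projective comodule -/

/-- The morphism `C → C ⊗_{C*} M`, `c ↦ c ⊗ m`. -/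
noncomputable def tensorMk (M : RComod k C) (m : M.carrier) : regular k C ⟶ balancedTensor M :=
  (⟨(balancedRel M).mkQ ∘ₗ (TensorProduct.mk k C M.carrier).flip m, by
    refine LinearMap.ext fun (c : C) => ?_
    change balancedCoact M ((balancedRel M).mkQ (c ⊗ₜ[k] m)) =
      ((balancedRel M).mkQ ∘ₗ (TensorProduct.mk k C M.carrier).flip m).rTensor C
        (Coalgebra.comul (R := k) (A := C) c)
    rw [balancedCoact_mk, preCoact, LinearMap.comp_apply, LinearMap.rTensor_tmul]
    induction (Coalgebra.comul (R := k) (A := C) c) with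
    | zero => simp
    | add x y hx hy => simp only [map_add, TensorProduct.add_tmul, hx, hy]
    | tmul a b => simp⟩ : Hom (regular k C) (balancedTensor M))

theorem tensorMk_add (M : RComod k C) (m m' : M.carrier) :
    tensorMk M (m + m') = tensorMk M m + tensorMk M m' :=
  hom_ext_apply fun (c : C) =>
    (congrArg (balancedRel M).mkQ (TensorProduct.tmul_add c m m')).trans (map_add _ _ _)

theorem tensorMk_sum (M : RComod k C) {ι : Type*} (s : Finset ι) (m : ι → M.carrier) :
    tensorMk M (∑ i ∈ s, m i) = ∑ i ∈ s, tensorMk M (m i) :=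
  map_sum (AddMonoidHom.mk' (tensorMk M) (tensorMk_add M)) m s

theorem tensorMk_hitRight (M : RComod k C) (f : DualAlg k C) (m : M.carrier) :
    hitRightHom f ≫ tensorMk M m = tensorMk M (f • m) :=
  hom_ext_apply fun (c : C) =>
    (Submodule.Quotient.eq _).2 (Submodule.subset_span ⟨c, f, m, rfl⟩)

theorem balancedTensor_ext {M : RComod k C} {V : Type u} [AddCommGroup V] [Module k V]
    {φ ψ : (balancedTensor M).carrier →ₗ[k] V}
    (h : ∀ m c, φ (lin (tensorMk M m) c) = ψ (lin (tensorMk M m) c)) : φ = ψ := by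
  refine (LinearMap.cancel_right (Submodule.mkQ_surjective (balancedRel M))).1 ?_
  exact TensorProduct.ext' fun c m => h m c

theorem balancedTensor_hom_ext {M N : RComod k C} {φ ψ : balancedTensor M ⟶ N}
    (h : ∀ m, tensorMk M m ≫ φ = tensorMk M m ≫ ψ) : φ = ψ :=
  hom_ext (balancedTensor_ext fun m c => LinearMap.congr_fun (congrArg lin (h m)) c)

/-- The functional `c ⊗ m ↦ ⟨s(m), c⟩` on `C ⊗_{C*} M` given by a `C*`-linear map `s : M → C*`. -/
noncomputable def tensorFunctional {M : RComod k C}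
    (s : M.carrier →ₗ[DualAlg k C] DualAlg k C) : (balancedTensor M).carrier →ₗ[k] k :=
  (balancedRel M).liftQ (TensorProduct.lift
    ((WithConv.linearEquiv k (C →ₗ[k] k)).toLinearMap ∘ₗ s.restrictScalars k).flip) <| by
      refine Submodule.span_le.2 ?_
      rintro _ ⟨c, f, m, rfl⟩
      rw [SetLike.mem_coe, LinearMap.mem_ker, map_sub, sub_eq_zero]
      change (s m).ofConv (hitRight f c) = (s (f • m)).ofConv c
      rw [map_smul, smul_eq_mul, mul_apply_eq_hitRight]

theorem tensorMk_coeff {M : RComod k C} (s : M.carrier →ₗ[DualAlg k C] DualAlg k C)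
    (m : M.carrier) : tensorMk M m ≫ coeff (tensorFunctional s) = hitRightHom (s m) :=
  hom_regular_ext fun c =>
    (regularCounit_coeff _ _).trans (regularCounit_hitRightHom (s m) c).symm

namespace DualBasis

variable {P : RComod k C}

/-- The component `c ⊗ x ↦ c ↼ coord i x` of the inclusion of `C ⊗_{C*} P` into `C ^ n`. -/
noncomputable def component (D : DualBasis P) (i : Fin D.card) : balancedTensor P ⟶ regular k C :=
  coeff (tensorFunctional (D.coord i))

/-- The dual basis of `P` exhibits `C ⊗_{C*} P` as a direct summand of `C ^ n`. -/
theorem sum_component (D : DualBasis P) : ∑ i, D.component i ≫ tensorMk P (D.elem i) = 𝟙 _ := by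
  refine balancedTensor_hom_ext fun x => ?_
  rw [Preadditive.comp_sum, Category.comp_id]
  conv_rhs => rw [← D.sum_coord_smul x, tensorMk_sum]
  refine Finset.sum_congr rfl fun i _ => ?_
  rw [component, ← Category.assoc, tensorMk_coeff, tensorMk_hitRight]

theorem sum_component_apply (D : DualBasis P) (x : (balancedTensor P).carrier) :
    ∑ i, lin (tensorMk P (D.elem i)) (lin (D.component i) x) = x := by
  have h := congrArg (fun g => lin g x) D.sum_component
  simp only [lin_sum] at h
  exact h

theorem injective_balancedTensor (D : DualBasis P) : Injective (balancedTensor P) := by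
  refine ⟨fun {U V} g j hj => ?_⟩
  choose h hh using fun i => exists_extend_regular j (injective_of_mono j) (g ≫ D.component i)
  refine ⟨∑ i, h i ≫ tensorMk P (D.elem i), ?_⟩
  rw [Preadditive.comp_sum]
  simp_rw [← Category.assoc, hh, Category.assoc]
  rw [← Preadditive.comp_sum, D.sum_component, Category.comp_id]

theorem exists_lift (D : DualBasis P) {M N : RComod k C} (e : M ⟶ N)
    (he : Function.Surjective (lin e)) (g : P ⟶ N) : ∃ h : P ⟶ M, h ≫ e = g := by
  choose m hm using fun i => he (lin g (D.elem i))
  let φ : P.carrier →ₗ[DualAlg k C] M.carrier :=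
    ∑ i, (D.coord i).smulRight (m i)
  refine ⟨homOfLinear φ, hom_ext_apply fun x => ?_⟩
  have h1 : φ x = ∑ i, D.coord i x • m i := by simp [φ]
  change lin e (φ x) = lin g x
  rw [h1, map_sum]
  conv_rhs => rw [← D.sum_coord_smul x, map_sum]
  exact Finset.sum_congr rfl fun i _ => by rw [lin_smul, lin_smul, hm]

/-- A comodule with a dual basis is projective among all comodules. -/
theorem projective (D : DualBasis P) : Projective P :=
  ⟨fun g e _ => D.exists_lift e (surjective_of_epi e) g⟩

/-- A nonzero morphism `M → C ⊗_{C*} P` yields a nonzero morphism `P → M`, of the form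
`x ↦ coord i x • m`. -/
theorem exists_coord_smul_ne_zero (D : DualBasis P) {M : RComod k C}
    {g : M ⟶ balancedTensor P} (hg : g ≠ 0) :
    ∃ (i : Fin D.card) (x : P.carrier) (m : M.carrier), D.coord i x • m ≠ 0 := by
  by_contra! h
  apply hg
  have h0 : ∀ i, g ≫ D.component i = 0 := by
    intro i
    conv_lhs => rw [← Category.comp_id g, ← D.sum_component]
    rw [Preadditive.comp_sum, Preadditive.sum_comp]
    refine Finset.sum_eq_zero fun j _ => hom_regular_ext fun m => ?_
    have h1 : (g ≫ D.component j ≫ tensorMk P (D.elem j)) ≫ D.component i =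
        (g ≫ D.component j) ≫ hitRightHom (D.coord i (D.elem j)) := by
      rw [component, component, Category.assoc, Category.assoc, tensorMk_coeff, Category.assoc]
    rw [h1]
    refine (regularCounit_hitRightHom _ _).trans ((regularCounit_smul _ _).symm.trans ?_)
    rw [← lin_smul, h, map_zero]
    rfl
  rw [← Category.comp_id g, ← D.sum_component, Preadditive.comp_sum]
  refine Finset.sum_eq_zero fun i _ => ?_
  rw [← Category.assoc, h0, Limits.zero_comp]

theorem exists_hom_of_hom_tensor (D : DualBasis P) {M : RComod k C}
    {g : M ⟶ balancedTensor P} (hg : g ≠ 0) : ∃ h : P ⟶ M, h ≠ 0 := by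
  obtain ⟨i, x, m, h⟩ := D.exists_coord_smul_ne_zero hg
  refine ⟨homOfLinear ((D.coord i).smulRight m), fun h0 => h ?_⟩
  exact congrArg (fun g => lin g x) h0

/-- A nonzero morphism `g : P → M` yields a nonzero morphism `M → C ⊗_{C*} P`: if all of them
vanish, so do all products `coord i (elem j) • m`, and these determine `g`. -/
theorem exists_hom_tensor_of_hom (D : DualBasis P) {M : RComod k C} {g : P ⟶ M} (hg : g ≠ 0) :
    ∃ h : M ⟶ balancedTensor P, h ≠ 0 := by
  by_contra! h
  apply hg
  have h1 : ∀ i j (m : M.carrier), D.coord i (D.elem j) • m = 0 := by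
    intro i j m
    refine eq_of_dual fun (ξ : M.carrier →ₗ[k] k) => ?_
    have h2 : coeff ξ ≫ hitRightHom (D.coord i (D.elem j)) = 0 := by
      rw [← tensorMk_coeff, ← Category.assoc, h (coeff ξ ≫ tensorMk P (D.elem j)),
        Limits.zero_comp]
    have h3 := congrArg (fun g => regularCounit k C (lin g m)) h2
    rw [map_zero, ← apply_coeff]
    exact (regularCounit_hitRightHom _ _).symm.trans (h3.trans (map_zero _))
  have h2 : ∀ j, lin g (D.elem j) = 0 := by
    intro j
    rw [← D.sum_coord_smul (D.elem j), map_sum]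
    exact Finset.sum_eq_zero fun i _ => by rw [lin_smul, h1]
  refine hom_ext_apply fun x => ?_
  rw [← D.sum_coord_smul x, map_sum]
  exact Finset.sum_eq_zero fun i _ => by rw [lin_smul, h2, smul_zero]

/-- The elements of `C ⊗_{C*} P` killed by the annihilator of `P` lie in the finite-dimensional
space of elements whose components are combinations of matrix coefficients of `P`. -/
theorem finite_of_annihilated (D : DualBasis P) (hP : finDim k C P)
    (L : Submodule k (balancedTensor P).carrier)
    (hL : ∀ x ∈ L, ∀ f : DualAlg k C, (∀ y : P.carrier, f • y = 0) → f • x = 0) :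
    Module.Finite k L := by
  have : Module.Finite k P.carrier := hP
  let b := Module.finBasis k P.carrier
  let W : Submodule k C := Submodule.span k
    (Set.range fun q : Fin _ × Fin _ => (lin (coeff (b.coord q.1)) (b q.2) : C))
  have : Module.Finite k W := Module.Finite.of_fg (Submodule.fg_span (Set.finite_range _))
  have hmem : ∀ x ∈ L, ∀ i, (lin (D.component i) x : C) ∈ W := by
    intro x hx i
    by_contra hc
    obtain ⟨f, hf, hf'⟩ := W.exists_le_ker_of_notMem hc
    apply hf
    have h0 : ∀ y : P.carrier, WithConv.toConv f • y = 0 := by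
      intro y
      rw [← b.sum_repr y, Finset.smul_sum]
      refine Finset.sum_eq_zero fun j _ => ?_
      have h1 : WithConv.toConv f • b j = 0 := by
        refine b.ext_elem fun i => ?_
        rw [map_zero, Finsupp.zero_apply]
        refine (apply_coeff (b.coord i) (WithConv.toConv f) (b j)).symm.trans ?_
        exact hf' (Submodule.subset_span ⟨(i, j), rfl⟩)
      rw [← algebraMap_smul (DualAlg k C) (b.repr y j) (b j), smul_smul, ← Algebra.commutes,
        mul_smul, h1, smul_zero]
    refine (apply_coeff _ (WithConv.toConv f) x).trans ?_
    rw [hL x hx _ h0, map_zero]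
  refine Module.Finite.of_injective (LinearMap.pi fun i =>
    (((lin (D.component i)).restrict (p := L) (q := W) fun x hx => hmem x hx i)) :
      L →ₗ[k] Fin D.card → W) ?_
  refine (injective_iff_map_eq_zero _).2 fun x hx => Subtype.ext ?_
  rw [← D.sum_component_apply x]
  refine Finset.sum_eq_zero fun i _ => ?_
  have h1 : (lin (D.component i) (x : (balancedTensor P).carrier) : C) = 0 :=
    congrArg Subtype.val (congrFun hx i)
  exact (congrArg (lin (tensorMk P (D.elem i))) h1).trans (map_zero _)

end DualBasis

/-! ### The adjunction between the two Nakayama functors -/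

/-- The `C*`-linear map `M → Hom^C(C, C ⊗_{C*} M)`, `m ↦ (c ↦ c ⊗ m)`. -/
noncomputable def unitLin (M : RComod k C) :
    M.carrier →ₗ[DualAlg k C] regularHom (balancedTensor M) where
  toFun m := ⟨lin (tensorMk M m), (tensorMk M m).comm⟩
  map_add' m m' := Subtype.ext (congrArg lin (tensorMk_add M m m'))
  map_smul' f m := Subtype.ext (congrArg lin (tensorMk_hitRight M f m)).symm

/-- The unit `M → Hom^C(C, C ⊗_{C*} M)^rat`. -/
noncomputable def unitHom (M : RComod k C) : M ⟶ (nakayamaL k C).obj ((nakayamaR k C).obj M) :=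
  toRat (unitLin M)

theorem unitHom_naturality {M N : RComod k C} (g : M ⟶ N) :
    g ≫ unitHom N = unitHom M ≫ (nakayamaL k C).map ((nakayamaR k C).map g) := rfl

/-- The evaluation `C ⊗_{C*} Hom^C(C, X)^rat → X`, `c ⊗ φ ↦ φ(c)`. -/
noncomputable def counitLin (X : RComod k C) :
    (balancedTensor (rat k C (regularHom X))).carrier →ₗ[k] X.carrier :=
  (balancedRel _).liftQ (TensorProduct.lift
    ((regularHom X).subtype ∘ₗ (ratPart k C (regularHom X)).subtype).flip) <| by
      refine Submodule.span_le.2 ?_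
      rintro _ ⟨c, f, φ, rfl⟩
      rw [SetLike.mem_coe, LinearMap.mem_ker, map_sub, sub_eq_zero]
      exact congrArg (fun ψ : regularHom X => ψ.1 c)
        (map_smul (ratIncl k C (regularHom X)) f φ).symm

/-- The counit `C ⊗_{C*} Hom^C(C, X)^rat → X`. -/
noncomputable def counitHom (X : RComod k C) : (nakayamaR k C).obj ((nakayamaL k C).obj X) ⟶ X :=
  (⟨counitLin X, balancedTensor_ext fun φ c => by
    have h := LinearMap.congr_fun (tensorMk _ φ).comm c
    simp only [LinearMap.comp_apply] at h ⊢
    rw [h, ← LinearMap.comp_apply (LinearMap.rTensor C _), ← LinearMap.rTensor_comp]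
    exact LinearMap.congr_fun (ratIncl k C (regularHom X) φ).2 c⟩ :
      Hom (balancedTensor (rat k C (regularHom X))) X)

theorem counitHom_naturality {X Y : RComod k C} (g : X ⟶ Y) :
    counitHom X ≫ g = (nakayamaR k C).map ((nakayamaL k C).map g) ≫ counitHom Y :=
  balancedTensor_hom_ext fun _ => rfl

/-- One of the triangle identities of the adjunction. -/
theorem map_unitHom_counitHom (M : RComod k C) :
    (nakayamaR k C).map (unitHom M) ≫ counitHom ((nakayamaR k C).obj M) = 𝟙 _ :=
  balancedTensor_hom_ext fun _ => rfl

/-- Via the decomposition of `C ⊗_{C*} P` as a summand of `C ^ n`, a morphism `φ : C → C ⊗_{C*} P`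
is `c ↦ c ⊗ ∑ gᵢ • elem i` with `gᵢ` the counit applied to the `i`-th component of `φ`. -/
theorem DualBasis.isIso_unitHom {P : RComod k C} (D : DualBasis P) : IsIso (unitHom P) := by
  refine isIso_of_bijective _ ⟨(injective_iff_map_eq_zero _).2 fun x hx => ?_, fun φ => ?_⟩
  · have h1 : tensorMk P x = 0 :=
      hom_ext (congrArg (fun ψ => (ratIncl k C (regularHom (balancedTensor P)) ψ).1) hx)
    rw [← D.sum_coord_smul x]
    refine Finset.sum_eq_zero fun i _ => ?_
    have h2 : D.coord i x = 0 := by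
      ext c
      have h3 := congrArg (fun g => tensorFunctional (D.coord i) (lin g c)) h1
      exact h3.trans (map_zero _)
    exact (congrArg (· • D.elem i) h2).trans (zero_smul (DualAlg k C) (D.elem i))
  · let φ' : regular k C ⟶ balancedTensor P :=
      (⟨(ratIncl k C (regularHom (balancedTensor P)) φ).1,
        (ratIncl k C (regularHom (balancedTensor P)) φ).2⟩ : Hom (regular k C) (balancedTensor P))
    let g : Fin D.card → DualAlg k C := fun i =>
      WithConv.toConv (regularCounit k C ∘ₗ lin (φ' ≫ D.component i))
    have hg : ∀ i, φ' ≫ D.component i = hitRightHom (g i) := fun i =>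
      hom_regular_ext fun c => (counit_hitRight (g i) c).symm
    refine ⟨∑ i, g i • D.elem i, ratIncl_injective (Subtype.ext ?_)⟩
    change lin (tensorMk P (∑ i, g i • D.elem i)) = lin φ'
    rw [tensorMk_sum, ← Category.comp_id φ', ← D.sum_component, Preadditive.comp_sum]
    congr 1
    refine Finset.sum_congr rfl fun i _ => ?_
    rw [← Category.assoc, hg, tensorMk_hitRight]

/-! ### Simple comodules and the socle -/

theorem exists_ne_zero_of_hom_ne_zero {M N : RComod k C} {g : M ⟶ N} (hg : g ≠ 0) :
    ∃ m, lin g m ≠ 0 := by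
  by_contra! h
  exact hg (hom_ext_apply h)

theorem eq_bot_or_eq_top_of_simple {S : RComod k C} [Simple S]
    (K : Submodule (DualAlg k C) S.carrier) : K = ⊥ ∨ K = ⊤ := by
  have : Mono (subHom K) := mono_of_injective (subHom_injective K)
  by_cases h : subHom K = 0
  · refine Or.inl (eq_bot_iff.2 fun x hx => ?_)
    obtain ⟨y, rfl⟩ := exists_subHom_eq K hx
    rw [h]
    exact Submodule.zero_mem _
  · have := isIso_of_mono_of_nonzero h
    refine Or.inr (eq_top_iff.2 fun x _ => ?_)
    obtain ⟨y, rfl⟩ := (bijective_of_isIso (subHom K)).2 x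
    exact subHom_mem K y

theorem exists_ne_zero_of_simple (S : RComod k C) [Simple S] : ∃ x : S.carrier, x ≠ 0 :=
  exists_ne_zero_of_hom_ne_zero (id_nonzero S)

theorem injective_of_simple {S M : RComod k C} [Simple S] {f : S ⟶ M} (hf : f ≠ 0) :
    Function.Injective (lin f) := by
  rcases eq_bot_or_eq_top_of_simple (LinearMap.ker (linStar f)) with h | h
  · exact (LinearMap.ker_eq_bot (f := linStar f)).1 h
  · refine absurd (hom_ext_apply fun x => ?_) hf
    exact LinearMap.mem_ker.1 (h.ge (Submodule.mem_top : x ∈ ⊤))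

theorem surjective_of_simple {S M : RComod k C} [Simple S] {f : M ⟶ S} (hf : f ≠ 0) :
    Function.Surjective (lin f) := by
  rcases eq_bot_or_eq_top_of_simple (LinearMap.range (linStar f)) with h | h
  · refine absurd (hom_ext_apply fun x => ?_) hf
    exact (Submodule.mem_bot (DualAlg k C)).1 (h.le ⟨x, rfl⟩)
  · exact (LinearMap.range_eq_top (f := linStar f)).1 h

theorem finDim_of_simple (S : RComod k C) [Simple S] : finDim k C S := by
  obtain ⟨x, hx⟩ := exists_ne_zero_of_simple S
  obtain ⟨K, hxK, hK⟩ := exists_finDim_sub S x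
  rcases eq_bot_or_eq_top_of_simple K with rfl | rfl
  · exact absurd ((Submodule.mem_bot _).1 hxK) hx
  · exact finite_of_surjective (subHom ⊤) (fun y => exists_subHom_eq ⊤ Submodule.mem_top) hK

theorem simple_sub {M : RComod k C} {K : Submodule (DualAlg k C) M.carrier} (hK : IsAtom K) :
    Simple (sub K) := by
  refine ⟨fun {Y} f hf => ⟨?_, fun hne => ?_⟩⟩
  · rintro hiso rfl
    apply hK.1
    refine eq_bot_iff.2 fun x hx => ?_
    obtain ⟨y, rfl⟩ := exists_subHom_eq K hx
    obtain ⟨z, rfl⟩ := (bijective_of_isIso (0 : Y ⟶ sub K)).2 y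
    exact (Submodule.mem_bot _).2 (map_zero _)
  · refine isIso_of_bijective f ⟨injective_of_mono f, fun y => ?_⟩
    have hle : LinearMap.range (linStar (f ≫ subHom K)) ≤ K := by
      rintro _ ⟨z, rfl⟩
      exact subHom_mem K _
    rcases hK.le_iff.1 hle with h | h
    · refine absurd (hom_ext_apply fun z => subHom_injective K ?_) hne
      refine Eq.trans ?_ (map_zero _).symm
      exact (Submodule.mem_bot (DualAlg k C)).1 (h.le ⟨z, rfl⟩)
    · obtain ⟨z, hz⟩ := h.ge (subHom_mem K y)
      exact ⟨z, subHom_injective K hz⟩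

/-- Every nonzero subcomodule contains a simple one. -/
theorem exists_atom_le {M : RComod k C} {K : Submodule (DualAlg k C) M.carrier} (hK : K ≠ ⊥) :
    ∃ A, IsAtom A ∧ A ≤ K := by
  obtain ⟨x, hxK, hx⟩ := K.ne_bot_iff.1 hK
  obtain ⟨L, hxL, hL⟩ := exists_finDim_sub M x
  obtain ⟨A, ⟨hA0, hAK, hAfin⟩, hmin⟩ := exists_minimalFor_of_wellFoundedLT
    (fun A : Submodule (DualAlg k C) M.carrier => A ≠ ⊥ ∧ A ≤ K ∧ finDim k C (sub A))
    (fun A => Module.finrank k (sub A).carrier)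
    ⟨K ⊓ L, (K ⊓ L).ne_bot_iff.2 ⟨x, ⟨hxK, hxL⟩, hx⟩, inf_le_left,
      finDim_sub_of_le hL inf_le_right⟩
  refine ⟨A, ⟨hA0, fun B hB => ?_⟩, hAK⟩
  by_contra hB0
  have hBfin := finDim_sub_of_le hAfin hB.le
  let j := subLift A (subHom B) fun x => hB.le (subHom_mem B x)
  have hj : Function.Injective (lin j) := fun x y hxy =>
    subHom_injective B (congrArg (lin (subHom A)) hxy)
  have : Module.Finite k (sub A).carrier := hAfin
  have : Module.Finite k (sub B).carrier := hBfin
  have hrank := le_antisymm (LinearMap.finrank_le_finrank_of_injective hj)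
    (hmin ⟨hB0, hB.le.trans hAK, hBfin⟩ (LinearMap.finrank_le_finrank_of_injective hj))
  refine hB.not_ge fun y hy => ?_
  obtain ⟨y, rfl⟩ := exists_subHom_eq A hy
  obtain ⟨z, rfl⟩ := (LinearMap.injective_iff_surjective_of_finrank_eq_finrank hrank).1 hj y
  exact subHom_mem B z

theorem isSimpleSubcomodule_iff (M : RComod k C) (N : Submodule k M.carrier) :
    M.IsSimpleSubcomodule N ↔
      ∃ K : Submodule (DualAlg k C) M.carrier, IsAtom K ∧ K.restrictScalars k = N := by
  constructor
  · rintro ⟨hN, hN0, hmin⟩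
    obtain ⟨K, rfl⟩ := (isSubcomodule_iff M N).1 hN
    refine ⟨K, ⟨fun h => hN0 ((Submodule.restrictScalars_eq_bot_iff k _ _).2 h),
      fun L hL => ?_⟩, rfl⟩
    rcases hmin _ ((isSubcomodule_iff M _).2 ⟨L, rfl⟩) hL.le with h | h
    · exact (Submodule.restrictScalars_eq_bot_iff k _ _).1 h
    · exact absurd (Submodule.restrictScalars_injective k _ _ h) hL.ne
  · rintro ⟨K, hK, rfl⟩
    refine ⟨(isSubcomodule_iff M _).2 ⟨K, rfl⟩,
      fun h => hK.1 ((Submodule.restrictScalars_eq_bot_iff k _ _).1 h), fun L hL hLK => ?_⟩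
    obtain ⟨L, rfl⟩ := (isSubcomodule_iff M L).1 hL
    rcases hK.le_iff.1 hLK with rfl | rfl
    · exact Or.inl (Submodule.restrictScalars_bot _ _ _)
    · exact Or.inr rfl

/-- The socle as a `C*`-submodule. -/
noncomputable def socleStar (M : RComod k C) : Submodule (DualAlg k C) M.carrier :=
  sSup {K | IsAtom K}

theorem restrictScalars_socleStar (M : RComod k C) :
    (socleStar M).restrictScalars k = M.socle := by
  rw [socleStar, Submodule.restrictScalars_sSup, socle]
  congr 1
  ext N
  rw [Set.mem_ofPred_eq, isSimpleSubcomodule_iff]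
  rfl

theorem hasFiniteSocle_of_finite (M : RComod k C) [Module.Finite k M.socle] :
    M.HasFiniteSocle := by
  let φ : {L : Submodule k M.carrier // M.IsSubcomodule L ∧ L ≤ M.socle} → Submodule k M.socle :=
    fun L => L.1.comap M.socle.subtype
  have hφ : StrictMono φ := by
    intro K L hKL
    refine lt_of_le_of_ne (Submodule.comap_mono hKL.le) fun h => hKL.ne (Subtype.ext ?_)
    have h1 := congrArg (Submodule.map M.socle.subtype) h
    simp only [φ, Submodule.map_comap_subtype, inf_eq_right.2 K.2.2, inf_eq_right.2 L.2.2] at h1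
    exact h1
  refine Order.finiteDimensionalOrder_iff_krullDim_ne_bot_and_top.2 ⟨?_, ?_⟩
  · have : Nonempty {L : Submodule k M.carrier // M.IsSubcomodule L ∧ L ≤ M.socle} :=
      ⟨⟨⊥, (isSubcomodule_iff M _).2 ⟨⊥, Submodule.restrictScalars_bot _ _ _⟩, bot_le⟩⟩
    exact Order.krullDim_ne_bot_iff.2 this
  · exact fun h => Order.krullDim_ne_top_of_finiteDimensionalOrder (α := Submodule k M.socle)
      (top_le_iff.1 (h.ge.trans (Order.krullDim_le_of_strictMono φ hφ)))

/-- A socle of finite length is finite-dimensional, simple comodules being so. -/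
theorem finDim_socleStar {M : RComod k C} (h : M.HasFiniteSocle) :
    finDim k C (sub (socleStar M)) := by
  have : FiniteDimensionalOrder
    {L : Submodule k M.carrier // M.IsSubcomodule L ∧ L ≤ M.socle} := h
  -- A finite-dimensional subcomodule that is maximal in the socle contains all simple ones.
  obtain ⟨⟨L', hL', hLs⟩, hLfin, hmax⟩ := (SetRel.IsWellFounded.inv_of_finiteDimensional
    (r := {(a, b) : {L : Submodule k M.carrier // M.IsSubcomodule L ∧ L ≤ M.socle} ×
      {L : Submodule k M.carrier // M.IsSubcomodule L ∧ L ≤ M.socle} | a < b})).has_min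
    {L | ∃ K : Submodule (DualAlg k C) M.carrier, K.restrictScalars k = L.1 ∧ finDim k C (sub K)}
    (by
      obtain ⟨K, -, hK⟩ := exists_finDim_sub M 0
      exact ⟨⟨⊥, (isSubcomodule_iff M _).2 ⟨⊥, Submodule.restrictScalars_bot _ _ _⟩, bot_le⟩,
        ⊥, Submodule.restrictScalars_bot _ _ _, finDim_sub_of_le hK bot_le⟩)
  obtain ⟨L, rfl, hLfin⟩ := hLfin
  refine finDim_sub_of_le hLfin (sSup_le fun A hA => ?_)
  by_contra hAL
  have := simple_sub hA
  have hsoc : (L ⊔ A).restrictScalars k ≤ M.socle := by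
    rw [← restrictScalars_socleStar] at hLs ⊢
    exact sup_le (a := L) (b := A) hLs (le_sSup hA)
  refine hmax ⟨(L ⊔ A).restrictScalars k, (isSubcomodule_iff M _).2 ⟨_, rfl⟩, hsoc⟩
    ⟨_, rfl, finDim_sub_sup hLfin (finDim_of_simple (sub A))⟩ ?_
  exact left_lt_sup.2 hAL

/-- A morphism that is injective on the socle is injective. -/
theorem injective_of_injective_socle {M N : RComod k C} (f : M ⟶ N)
    (hf : Function.Injective (lin (subHom (socleStar M) ≫ f))) : Function.Injective (lin f) := by
  by_contra h
  have hker : LinearMap.ker (linStar f) ≠ ⊥ := fun h0 =>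
    h ((LinearMap.ker_eq_bot (f := linStar f)).1 h0)
  obtain ⟨A, hA, hAker⟩ := exists_atom_le hker
  refine hA.1 (eq_bot_iff.2 fun x hx => ?_)
  obtain ⟨y, rfl⟩ := exists_subHom_eq (socleStar M) (le_sSup (s := {K | IsAtom K}) hA hx)
  have : y = 0 := hf ((hAker hx).trans (map_zero _).symm)
  rw [this]
  exact (Submodule.mem_bot _).2 (map_zero _)

/-- Every simple subcomodule of `C ⊗_{C*} P` is a quotient of `P`, so the annihilator of `P` kills
the socle. -/
theorem DualBasis.finite_socle {P : RComod k C} (D : DualBasis P) (hP : finDim k C P) :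
    Module.Finite k (balancedTensor P).socle := by
  refine D.finite_of_annihilated hP _ fun x hx f hf => ?_
  let L : Submodule k (balancedTensor P).carrier :=
    { carrier := {x | f • x = 0}
      zero_mem' := smul_zero f
      add_mem' := fun {x y} hx hy => by
        rw [Set.mem_ofPred_eq] at hx hy ⊢
        rw [smul_add, hx, hy, add_zero]
      smul_mem' := fun a x hx => by
        rw [Set.mem_ofPred_eq] at hx ⊢
        rw [← algebraMap_smul (DualAlg k C) a x, smul_smul, ← Algebra.commutes, mul_smul, hx,
          smul_zero] }
  refine (sSup_le fun N hN => ?_ : (balancedTensor P).socle ≤ L) hx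
  obtain ⟨A, hA, rfl⟩ := (isSimpleSubcomodule_iff _ N).1 hN
  have := simple_sub hA
  have hne : subHom A ≠ 0 := fun h0 => hA.1 <| eq_bot_iff.2 fun x hx => by
    obtain ⟨y, rfl⟩ := exists_subHom_eq A hx
    rw [h0]
    exact Submodule.zero_mem _
  obtain ⟨g, hg⟩ := D.exists_hom_of_hom_tensor hne
  intro x hx
  obtain ⟨y, rfl⟩ := exists_subHom_eq A hx
  obtain ⟨z, rfl⟩ := surjective_of_simple hg y
  change f • lin (subHom A) (lin g z) = 0
  rw [← lin_smul, ← lin_smul, hf, map_zero, map_zero]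

theorem DualBasis.injSF_balancedTensor {P : RComod k C} (D : DualBasis P) (hP : finDim k C P) :
    injSF k C (balancedTensor P) :=
  ⟨D.injective_balancedTensor,
    have := D.finite_socle hP
    hasFiniteSocle_of_finite _⟩

/-! ### Injective hulls -/

/-- Zorn's lemma: a submodule disjoint from `B` lies in a maximal one. -/
theorem exists_maximal_disjoint {M : RComod k C} {A B : Submodule (DualAlg k C) M.carrier}
    (h : Disjoint A B) :
    ∃ E, A ≤ E ∧ Disjoint E B ∧ ∀ E', E ≤ E' → Disjoint E' B → E' ≤ E := by
  obtain ⟨E, hAE, hE⟩ := zorn_le_nonempty₀ {E : Submodule (DualAlg k C) M.carrier | Disjoint E B}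
    (fun c hc hchain y hy => ⟨sSup c, hchain.directedOn.disjoint_sSup_left.2 fun K hK => hc hK,
      fun z hz => le_sSup hz⟩) A h
  exact ⟨E, hAE, hE.1, fun E' hE' hd => hE.2 hd hE'⟩

theorem injective_of_retract {X Y : RComod k C} (i : Y ⟶ X) (r : X ⟶ Y) (h : i ≫ r = 𝟙 Y)
    [Injective X] : Injective Y :=
  ⟨fun g j _ => ⟨Injective.factorThru (g ≫ i) j ≫ r, by
    rw [← Category.assoc, Injective.comp_factorThru, Category.assoc, h, Category.comp_id]⟩⟩

/-- A subcomodule of an injective comodule has an injective hull: if `K` is maximal with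
`K ∩ A = 0` and `E ⊇ A` is maximal with `E ∩ K = 0`, then `E` is a complement of `K` and `A` is
essential in `E`. -/
theorem exists_injectiveHull_of_injective {S I : RComod k C} (j : S ⟶ I)
    (hj : Function.Injective (lin j)) [Injective I] :
    ∃ (E : RComod k C) (i : S ⟶ E), IsInjectiveHull i := by
  let A : Submodule (DualAlg k C) I.carrier := LinearMap.range (linStar j)
  obtain ⟨K, -, hKA, hKmax⟩ := exists_maximal_disjoint (disjoint_bot_left : Disjoint ⊥ A)
  obtain ⟨E, hAE, hEK, hEmax⟩ := exists_maximal_disjoint hKA.symm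
  have hess : ∀ U ≤ E, Disjoint U A → U = ⊥ := by
    intro U hU hUA
    have h1 : Disjoint (A ⊔ U) K := hEK.mono_left (sup_le hAE hU)
    have h2 : Disjoint (K ⊔ U) A := by
      rw [sup_comm]
      exact (hUA.symm.disjoint_sup_right_of_disjoint_sup_left h1).symm
    exact disjoint_self.1 (hEK.mono hU (le_sup_right.trans (hKmax _ le_sup_left h2)))
  -- An endomorphism `H` of `I` that kills `K` and fixes `E`.
  have hmono : Mono (subHom E ≫ quotHom K) := by
    refine mono_of_injective ((injective_iff_map_eq_zero _).2 fun x hx => ?_)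
    have h1 : lin (subHom E) x ∈ K := (quotHom_eq_zero K _).1 hx
    exact subHom_injective E
      ((Submodule.disjoint_def.1 hEK _ (subHom_mem E x) h1).trans (map_zero _).symm)
  let H : I ⟶ I := quotHom K ≫ Injective.factorThru (subHom E) (subHom E ≫ quotHom K)
  have hHE : ∀ x ∈ E, lin H x = x := by
    intro x hx
    obtain ⟨y, rfl⟩ := exists_subHom_eq E hx
    exact comp_apply_eq (Injective.comp_factorThru (subHom E) (subHom E ≫ quotHom K)) y
  have hHK : ∀ x ∈ K, lin H x = 0 := fun x hx =>
    (congrArg (lin (Injective.factorThru (subHom E) (subHom E ≫ quotHom K)))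
      ((quotHom_eq_zero K x).2 hx)).trans (map_zero (lin _))
  have hker : LinearMap.ker (linStar (H ≫ H)) ≤ K := by
    refine hKmax _ (fun x hx => ?_) (Submodule.disjoint_def.2 fun x hx hxA => ?_)
    · change lin H (lin H x) = 0
      rw [hHK x hx, map_zero]
    · have hx' : lin H (lin H x) = 0 := hx
      rw [hHE x (hAE hxA), hHE x (hAE hxA)] at hx'
      exact hx'
  have hrange : LinearMap.range (linStar H) ≤ E := by
    refine hEmax _ (fun x hx => ⟨x, hHE x hx⟩) (Submodule.disjoint_def.2 ?_)
    rintro _ ⟨x, rfl⟩ hxK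
    exact hHK x (hker (hHK _ hxK))
  let i : S ⟶ sub E := subLift E j fun x => hAE ⟨x, rfl⟩
  have hi : Function.Injective (lin i) := fun x y hxy => hj (congrArg (lin (subHom E)) hxy)
  refine ⟨sub E, i, ⟨?_, mono_of_injective hi, fun {Y} g hg => ?_⟩⟩
  · refine injective_of_retract (subHom E) (subLift E H fun x => hrange ⟨x, rfl⟩) ?_
    exact hom_ext_apply fun x => subHom_injective E (hHE _ (subHom_mem E x))
  · refine mono_of_injective ((injective_iff_map_eq_zero _).2 fun x hx => ?_)
    have h0 : (LinearMap.ker (linStar g)).map (linStar (subHom E)) = ⊥ := by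
      refine hess _ ?_ (Submodule.disjoint_def.2 ?_)
      · rintro _ ⟨y, -, rfl⟩
        exact subHom_mem E y
      · rintro _ ⟨y, hy, rfl⟩ ⟨s, hs⟩
        have hy' : y = lin i s := subHom_injective E hs.symm
        have hs0 : s = 0 := by
          refine injective_of_mono (i ≫ g) (Eq.trans ?_ (map_zero _).symm)
          have : lin g y = 0 := hy
          rw [hy'] at this
          exact this
        rw [hy', hs0]
        exact map_zero (lin j)
    have h1 : lin (subHom E) x ∈ (⊥ : Submodule (DualAlg k C) I.carrier) := h0.le ⟨x, hx, rfl⟩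
    exact subHom_injective E (((Submodule.mem_bot _).1 h1).trans (map_zero _).symm)

/-- A nonzero functional on a simple comodule embeds it into the injective comodule `C`. -/
theorem exists_injectiveHull (S : RComod k C) [Simple S] :
    ∃ (E : RComod k C) (i : S ⟶ E), IsInjectiveHull i := by
  obtain ⟨x, hx⟩ := exists_ne_zero_of_simple S
  have : ∃ ξ : S.carrier →ₗ[k] k, ξ x ≠ 0 := by
    by_contra! h
    exact hx ((Module.forall_dual_apply_eq_zero_iff k x).1 h)
  obtain ⟨ξ, hξ⟩ := this
  have hne : coeff ξ ≠ 0 := fun h => hξ <| by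
    rw [← regularCounit_coeff ξ x, h]
    exact map_zero _
  have := injective_regular (k := k) (C := C)
  exact exists_injectiveHull_of_injective (coeff ξ) (injective_of_simple hne)

/-- The injective hull of a simple comodule has finite socle, for its socle is that comodule. -/
theorem injSF_of_isInjectiveHull {S E : RComod k C} [Simple S] {i : S ⟶ E}
    (hi : IsInjectiveHull i) : injSF k C E := by
  refine ⟨hi.injective, ?_⟩
  have := hi.mono
  have hinj := injective_of_mono i
  have hle : socleStar E ≤ LinearMap.range (linStar i) := by
    refine sSup_le fun A (hA : IsAtom A) => ?_
    by_contra hAR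
    have hdisj : A ⊓ LinearMap.range (linStar i) = ⊥ :=
      hA.2 _ (lt_of_le_of_ne inf_le_left fun h => hAR (inf_eq_left.1 h))
    have hmono : Mono (quotHom A) := hi.essential _ <| by
      refine mono_of_injective ((injective_iff_map_eq_zero _).2 fun s hs => hinj ?_)
      have h1 : lin i s ∈ A := (quotHom_eq_zero A _).1 hs
      exact ((Submodule.mem_bot _).1 (hdisj.le ⟨h1, s, rfl⟩)).trans (map_zero _).symm
    refine hA.1 (eq_bot_iff.2 fun x hx => (Submodule.mem_bot _).2 ?_)
    exact injective_of_mono (quotHom A) (((quotHom_eq_zero A x).2 hx).trans (map_zero _).symm)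
  have : Module.Finite k S.carrier := finDim_of_simple S
  have : Module.Finite k E.socle := by
    refine Submodule.finiteDimensional_of_le (S₂ := LinearMap.range (lin i)) ?_
    rw [← restrictScalars_socleStar]
    exact fun x hx => hle hx
  exact hasFiniteSocle_of_finite E

/-! ### Direct sums and retracts of projective comodules -/

/-- The direct sum of two comodules. -/
noncomputable def prod (M N : RComod k C) : RComod k C := rat k C (M.carrier × N.carrier)

/-- The first projection of a direct sum. -/
noncomputable def prodFst (M N : RComod k C) : prod M N ⟶ M :=
  homOfLinear (LinearMap.fst _ _ _ ∘ₗ ratIncl k C _)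

/-- The second projection of a direct sum. -/
noncomputable def prodSnd (M N : RComod k C) : prod M N ⟶ N :=
  homOfLinear (LinearMap.snd _ _ _ ∘ₗ ratIncl k C _)

/-- The first inclusion into a direct sum. -/
noncomputable def prodInl (M N : RComod k C) : M ⟶ prod M N := toRat (LinearMap.inl _ _ _)

/-- The second inclusion into a direct sum. -/
noncomputable def prodInr (M N : RComod k C) : N ⟶ prod M N := toRat (LinearMap.inr _ _ _)

@[simp] theorem prodInl_fst (M N : RComod k C) : prodInl M N ≫ prodFst M N = 𝟙 M := rfl

@[simp] theorem prodInl_snd (M N : RComod k C) : prodInl M N ≫ prodSnd M N = 0 := rfl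

@[simp] theorem prodInr_fst (M N : RComod k C) : prodInr M N ≫ prodFst M N = 0 := rfl

@[simp] theorem prodInr_snd (M N : RComod k C) : prodInr M N ≫ prodSnd M N = 𝟙 N := rfl

theorem prod_total (M N : RComod k C) :
    prodFst M N ≫ prodInl M N + prodSnd M N ≫ prodInr M N = 𝟙 _ :=
  hom_ext_apply fun _ => ratIncl_injective (Prod.ext (add_zero _) (zero_add _))

theorem projFD_prod {P Q : RComod k C} (hP : projFD k C P) (hQ : projFD k C Q) :
    projFD k C (prod P Q) := by
  obtain ⟨hPfin, hPlift⟩ := (projFD_iff P).1 hP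
  obtain ⟨hQfin, hQlift⟩ := (projFD_iff Q).1 hQ
  refine (projFD_iff _).2 ⟨?_, fun M N e g hM hN he => ?_⟩
  · have : Module.Finite k P.carrier := hPfin
    have : Module.Finite k Q.carrier := hQfin
    exact Module.Finite.of_injective ((ratIncl k C (P.carrier × Q.carrier)).restrictScalars k)
      ratIncl_injective
  · obtain ⟨a, ha⟩ := hPlift M N e (prodInl P Q ≫ g) hM hN he
    obtain ⟨b, hb⟩ := hQlift M N e (prodInr P Q ≫ g) hM hN he
    refine ⟨prodFst P Q ≫ a + prodSnd P Q ≫ b, ?_⟩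
    rw [Preadditive.add_comp, Category.assoc, Category.assoc, ha, hb, ← Category.assoc,
      ← Category.assoc, ← Preadditive.add_comp, prod_total, Category.id_comp]

theorem projFD_of_retract {P Q : RComod k C} (i : Q ⟶ P) (r : P ⟶ Q) (h : i ≫ r = 𝟙 Q)
    (hP : projFD k C P) : projFD k C Q := by
  obtain ⟨hfin, hlift⟩ := (projFD_iff P).1 hP
  refine (projFD_iff Q).2 ⟨?_, fun M N e g hM hN he => ?_⟩
  · exact finite_of_injective i
      (Function.LeftInverse.injective (g := lin r) fun x => comp_apply_eq h x) hfin
  · obtain ⟨a, ha⟩ := hlift M N e (r ≫ g) hM hN he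
    exact ⟨i ≫ a, by rw [Category.assoc, ha, ← Category.assoc, h, Category.id_comp]⟩

theorem projFD_of_projective {P : RComod k C} (h : Projective P) (hP : finDim k C P) :
    projFD k C P :=
  (projFD_iff P).2 ⟨hP, fun _ _ e g _ _ he =>
    have := epi_of_surjective he
    ⟨Projective.factorThru g e, Projective.factorThru_comp g e⟩⟩

theorem projFD_sub_bot (M : RComod k C) :
    projFD k C (sub (⊥ : Submodule (DualAlg k C) M.carrier)) := by
  have h0 : ∀ x : (sub (⊥ : Submodule (DualAlg k C) M.carrier)).carrier, x = 0 := fun x =>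
    subHom_injective _ (((Submodule.mem_bot _).1 (subHom_mem ⊥ x)).trans (map_zero _).symm)
  obtain ⟨K, -, hK⟩ := exists_finDim_sub M 0
  refine (projFD_iff _).2 ⟨finDim_sub_of_le hK bot_le,
    fun _ _ _ g _ _ _ => ⟨0, hom_ext_apply fun x => ?_⟩⟩
  rw [h0 x, map_zero, map_zero]

theorem projective_of_projFD {P : RComod k C} (h : projFD k C P) : Projective P :=
  (nonempty_dualBasis h).some.projective

/-! ### Enough finite-dimensional projective comodules -/

variable (k C) in
/-- Every nonzero comodule receives a nonzero morphism from a finite-dimensional projective one.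
This is the form in which the three equivalent conditions are compared. -/
def DetectedByProjFD : Prop :=
  ∀ M : RComod k C, (∃ m : M.carrier, m ≠ 0) →
    ∃ P : RComod k C, projFD k C P ∧ ∃ g : P ⟶ M, g ≠ 0

theorem detectedByProjFD_of_simple
    (h : ∀ S : RComod k C, Simple S → ∃ P : RComod k C, projFD k C P ∧ ∃ g : P ⟶ S, g ≠ 0) :
    DetectedByProjFD k C := by
  rintro M ⟨m, hm⟩
  obtain ⟨A, hA, -⟩ := exists_atom_le (K := (⊤ : Submodule (DualAlg k C) M.carrier))
    ((Submodule.ne_bot_iff _).2 ⟨m, Submodule.mem_top, hm⟩)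
  obtain ⟨P, hP, g, hg⟩ := h (sub A) (simple_sub hA)
  refine ⟨P, hP, g ≫ subHom A, fun h0 => hg ?_⟩
  have := mono_of_injective (subHom_injective A)
  rw [← cancel_mono (subHom A), h0, Limits.zero_comp]

/-- A projective cover of a finite-dimensional comodule is finite-dimensional: a
finite-dimensional subcomodule already maps onto the comodule. -/
theorem finDim_of_isProjectiveCover {P M : RComod k C} {π : P ⟶ M} (hM : finDim k C M)
    (hπ : IsProjectiveCover π) : finDim k C P := by
  classical
  have := hπ.epi
  have hsurj := surjective_of_epi π
  have : Module.Finite k M.carrier := hM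
  let b := Module.finBasis k M.carrier
  choose p hp using fun i => hsurj (b i)
  obtain ⟨K, hpK, hK⟩ := exists_finDim_sub_of_finset P (Finset.univ.image p)
  have hepi : Epi (subHom K ≫ π) := by
    refine epi_of_surjective (LinearMap.range_eq_top.1 (eq_top_iff.2 ?_))
    rw [← b.span_eq, Submodule.span_le]
    rintro _ ⟨i, rfl⟩
    obtain ⟨x, hx⟩ := exists_subHom_eq K
      (hpK (p i) (Finset.mem_image_of_mem p (Finset.mem_univ i)))
    exact ⟨x, (congrArg (lin π) hx).trans (hp i)⟩
  have := hπ.essential _ hepi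
  exact finite_of_surjective (subHom K) (surjective_of_epi _) hK

theorem detectedByProjFD_of_isRightSemiperfect (h : IsRightSemiperfect k C) :
    DetectedByProjFD k C := by
  refine detectedByProjFD_of_simple fun S hS => ?_
  obtain ⟨P, π, hπ⟩ := h S (finDim_of_simple S)
  refine ⟨P, projFD_of_projective hπ.projective
    (finDim_of_isProjectiveCover (finDim_of_simple S) hπ), π, ?_⟩
  rintro rfl
  obtain ⟨x, hx⟩ := exists_ne_zero_of_simple S
  have := hπ.epi
  obtain ⟨y, hy⟩ := surjective_of_epi (0 : P ⟶ S) x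
  exact hx hy.symm

/-- The largest image in `M` of a finite-dimensional projective comodule is `M`: otherwise some
projective has a nonzero morphism to the cokernel, and it lifts to `M`. -/
theorem exists_projFD_surjective (h : DetectedByProjFD k C) {M : RComod k C}
    (hM : finDim k C M) :
    ∃ (P : RComod k C) (π : P ⟶ M), projFD k C P ∧ Function.Surjective (lin π) := by
  have : Module.Finite k M.carrier := hM
  let T : Set (Submodule k M.carrier) :=
    {N | ∃ (P : RComod k C) (π : P ⟶ M), projFD k C P ∧ LinearMap.range (lin π) = N}
  have hT : T.Nonempty := ⟨_, _, 0, projFD_sub_bot M, rfl⟩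
  obtain ⟨_, ⟨P, π, hP, rfl⟩, hmax⟩ :=
    (wellFounded_gt (α := Submodule k M.carrier)).has_min T hT
  refine ⟨P, π, hP, ?_⟩
  by_contra hsurj
  let K := LinearMap.range (linStar π)
  have hK : ∃ y : (quot K).carrier, y ≠ 0 := by
    by_contra! h0
    exact hsurj fun m => (quotHom_eq_zero K m).1 (h0 _)
  obtain ⟨Q, hQ, g, hg⟩ := h (quot K) hK
  have := projective_of_projFD hQ
  have := epi_of_surjective (quotHom_surjective K)
  let g' : Q ⟶ M := Projective.factorThru g (quotHom K)
  have hg' : g' ≫ quotHom K = g := Projective.factorThru_comp g (quotHom K)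
  refine hmax _ ⟨_, prodFst P Q ≫ π + prodSnd P Q ≫ g', projFD_prod hP hQ, rfl⟩
    (lt_of_le_of_ne ?_ fun heq => hg (hom_ext_apply fun x => ?_))
  · rintro _ ⟨x, rfl⟩
    refine ⟨lin (prodInl P Q) x, comp_apply_eq (h := π) ?_ x⟩
    rw [Preadditive.comp_add, ← Category.assoc, ← Category.assoc, prodInl_fst, prodInl_snd,
      Category.id_comp, Limits.zero_comp, add_zero]
  · rw [← hg']
    refine (quotHom_eq_zero K _).2 (heq.ge ?_ : lin g' x ∈ LinearMap.range (lin π))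
    refine ⟨lin (prodInr P Q) x, comp_apply_eq (h := g') ?_ x⟩
    rw [Preadditive.comp_add, ← Category.assoc, ← Category.assoc, prodInr_fst, prodInr_snd,
      Category.id_comp, Limits.zero_comp, zero_add]

/-- A finite-dimensional projective comodule of smallest dimension that maps onto `M` is a
projective cover of `M`, by Fitting's lemma. -/
theorem isRightSemiperfect_of_detectedByProjFD (h : DetectedByProjFD k C) :
    IsRightSemiperfect k C := by
  intro M hM
  obtain ⟨⟨P, π⟩, ⟨hP, hπ⟩, hmin⟩ := exists_minimalFor_of_wellFoundedLT
    (fun q : Σ P : RComod k C, (P ⟶ M) => projFD k C q.1 ∧ Function.Surjective (lin q.2))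
    (fun q => Module.finrank k q.1.carrier)
    (by
      obtain ⟨P, π, hP, hπ⟩ := exists_projFD_surjective h hM
      exact ⟨⟨P, π⟩, hP, hπ⟩)
  have := projective_of_projFD hP
  have hPfin : Module.Finite k P.carrier := hP.1
  refine ⟨P, π, ⟨this, epi_of_surjective hπ, fun {Y} g hg => ?_⟩⟩
  -- Among the endomorphisms over `M` with image in that of `g`, one of minimal rank restricts to
  -- an automorphism of its image, which is therefore a direct summand of `P`.
  obtain ⟨s, ⟨hsπ, hsg⟩, hsmin⟩ := exists_minimalFor_of_wellFoundedLT
    (fun s : P ⟶ P => s ≫ π = π ∧ ∀ x, lin s x ∈ LinearMap.range (lin g))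
    (fun s => Module.finrank k (LinearMap.range (lin s)))
    ⟨Projective.factorThru π (g ≫ π) ≫ g, by
      rw [Category.assoc, Projective.factorThru_comp], fun x => ⟨_, rfl⟩⟩
  have hss : LinearMap.range (lin (s ≫ s)) ≤ LinearMap.range (lin s) := by
    rintro _ ⟨x, rfl⟩
    exact ⟨lin s x, rfl⟩
  have hrange : LinearMap.range (lin (s ≫ s)) = LinearMap.range (lin s) :=
    Submodule.eq_of_le_of_finrank_le hss
      (hsmin ⟨by rw [Category.assoc, hsπ, hsπ], fun x => hsg _⟩ (Submodule.finrank_mono hss))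
  let K := LinearMap.range (linStar s)
  have hKs : ∀ x, lin s x ∈ K := fun x => ⟨x, rfl⟩
  have hQfin : Module.Finite k (sub K).carrier :=
    finite_of_injective (subHom K) (subHom_injective K) hPfin
  have hq : Function.Surjective (lin (subHom K ≫ subLift K s hKs)) := by
    intro y
    obtain ⟨x, hx⟩ := subHom_mem K y
    obtain ⟨z, hz⟩ := hrange.ge (⟨x, rfl⟩ : lin s x ∈ LinearMap.range (lin s))
    obtain ⟨w, hw⟩ := exists_subHom_eq K (hKs z)
    refine ⟨w, subHom_injective K ?_⟩
    exact (congrArg (lin s) hw).trans (hz.trans hx)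
  have : IsIso (subHom K ≫ subLift K s hKs) :=
    isIso_of_bijective _ ⟨LinearMap.injective_iff_surjective.2 hq, hq⟩
  have hQ : projFD k C (sub K) := projFD_of_retract (subHom K)
    (subLift K s hKs ≫ inv (subHom K ≫ subLift K s hKs))
    (by rw [← Category.assoc, IsIso.hom_inv_id]) hP
  have hQπ : Function.Surjective (lin (subHom K ≫ π)) := by
    intro m
    obtain ⟨x, rfl⟩ := hπ m
    obtain ⟨y, hy⟩ := exists_subHom_eq K (hKs x)
    exact ⟨y, (congrArg (lin π) hy).trans (comp_apply_eq hsπ x)⟩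
  have hle := LinearMap.finrank_le_finrank_of_injective (subHom_injective K)
  have hsurj := (LinearMap.injective_iff_surjective_of_finrank_eq_finrank
    (le_antisymm hle (hmin (j := ⟨sub K, subHom K ≫ π⟩) ⟨hQ, hQπ⟩ hle))).1 (subHom_injective K)
  refine epi_of_surjective fun x => ?_
  obtain ⟨y, rfl⟩ := hsurj x
  obtain ⟨z, hz⟩ := subHom_mem K y
  rw [← hz]
  exact hsg z

/-! ### The Nakayama functors on injective and projective comodules -/

theorem nakayamaR_map_zero (M N : RComod k C) : (nakayamaR k C).map (0 : M ⟶ N) = 0 :=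
  balancedTensor_hom_ext fun _ => hom_ext_apply fun (c : C) =>
    (congrArg (balancedRel N).mkQ (TensorProduct.tmul_zero N.carrier c)).trans (map_zero _)

theorem injSF_nakayamaR {P : RComod k C} (hP : projFD k C P) :
    injSF k C ((nakayamaR k C).obj P) :=
  (nonempty_dualBasis hP).some.injSF_balancedTensor hP.1

theorem isIso_unitHom {P : RComod k C} (hP : projFD k C P) : IsIso (unitHom P) :=
  (nonempty_dualBasis hP).some.isIso_unitHom

/-- Every finite-dimensional comodule embeds into some `C ⊗_{C*} P`: a morphism with the smallest
possible kernel is injective, since a nonzero kernel has a nonzero morphism to some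
`C ⊗_{C*} P'`, which extends to the whole comodule. -/
theorem exists_injective_nakayamaR (h : DetectedByProjFD k C) {M : RComod k C}
    (hM : finDim k C M) :
    ∃ (P : RComod k C) (φ : M ⟶ (nakayamaR k C).obj P), projFD k C P ∧
      Function.Injective (lin φ) := by
  have : Module.Finite k M.carrier := hM
  obtain ⟨⟨P, φ⟩, hP, hmin⟩ := exists_minimalFor_of_wellFoundedLT
    (fun q : Σ P : RComod k C, (M ⟶ (nakayamaR k C).obj P) => projFD k C q.1)
    (fun q => Module.finrank k (LinearMap.ker (lin q.2))) ⟨⟨_, 0⟩, projFD_sub_bot M⟩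
  refine ⟨P, φ, hP, ?_⟩
  by_contra hφ
  let K := LinearMap.ker (linStar φ)
  have hK : ∃ x : (sub K).carrier, x ≠ 0 := by
    by_contra! h0
    refine hφ ((injective_iff_map_eq_zero _).2 fun x hx => ?_)
    obtain ⟨y, rfl⟩ := exists_subHom_eq K hx
    rw [h0 y, map_zero]
  obtain ⟨P', hP', g, hg⟩ := h (sub K) hK
  obtain ⟨ψ, hψ⟩ : ∃ ψ : sub K ⟶ (nakayamaR k C).obj P', ψ ≠ 0 :=
    (nonempty_dualBasis hP').some.exists_hom_tensor_of_hom hg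
  have := (injSF_nakayamaR hP').1
  have := mono_of_injective (subHom_injective K)
  let ψ' : M ⟶ (nakayamaR k C).obj P' := Injective.factorThru ψ (subHom K)
  have hψ' : subHom K ≫ ψ' = ψ := Injective.comp_factorThru ψ (subHom K)
  let θ : M ⟶ (nakayamaR k C).obj (prod P P') :=
    φ ≫ (nakayamaR k C).map (prodInl P P') + ψ' ≫ (nakayamaR k C).map (prodInr P P')
  have hθ1 : θ ≫ (nakayamaR k C).map (prodFst P P') = φ := by
    rw [Preadditive.add_comp, Category.assoc, Category.assoc, ← Functor.map_comp,
      ← Functor.map_comp, prodInl_fst, prodInr_fst, nakayamaR_map_zero,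
      CategoryTheory.Functor.map_id, Category.comp_id, Limits.comp_zero, add_zero]
  have hθ2 : θ ≫ (nakayamaR k C).map (prodSnd P P') = ψ' := by
    rw [Preadditive.add_comp, Category.assoc, Category.assoc, ← Functor.map_comp,
      ← Functor.map_comp, prodInl_snd, prodInr_snd, nakayamaR_map_zero,
      CategoryTheory.Functor.map_id, Category.comp_id, Limits.comp_zero, zero_add]
  have hlt : LinearMap.ker (lin θ) < LinearMap.ker (lin φ) := by
    refine lt_of_le_of_ne (fun x hx => ?_) fun heq => hψ (hom_ext_apply fun x => ?_)
    · rw [LinearMap.mem_ker] at hx ⊢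
      rw [← comp_apply_eq hθ1 x, hx, map_zero]
    · have hx : lin θ (lin (subHom K) x) = 0 := heq.ge (subHom_mem K x)
      rw [← comp_apply_eq hψ' x, ← comp_apply_eq hθ2, hx, map_zero]
      rfl
  have hrank := Submodule.finrank_lt_finrank_of_lt hlt
  exact hrank.not_ge (hmin (j := ⟨prod P P', θ⟩) (projFD_prod hP hP') hrank.le)

/-- Every injective comodule with finite socle is a direct summand of some `C ⊗_{C*} P`. -/
theorem exists_retract_nakayamaR (h : DetectedByProjFD k C) {X : RComod k C}
    (hX : injSF k C X) :
    ∃ (P : RComod k C) (i : X ⟶ (nakayamaR k C).obj P) (r : (nakayamaR k C).obj P ⟶ X),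
      projFD k C P ∧ i ≫ r = 𝟙 X := by
  have := hX.1
  obtain ⟨P, φ, hP, hφ⟩ := exists_injective_nakayamaR h (finDim_socleStar hX.2)
  have := (injSF_nakayamaR hP).1
  have := mono_of_injective (subHom_injective (socleStar X))
  have hi : Function.Injective (lin (Injective.factorThru φ (subHom (socleStar X)))) :=
    injective_of_injective_socle _ (by rw [Injective.comp_factorThru]; exact hφ)
  have := mono_of_injective hi
  exact ⟨P, _, Injective.factorThru (𝟙 X) (Injective.factorThru φ (subHom (socleStar X))), hP,
    Injective.comp_factorThru _ _⟩

theorem projFD_nakayamaL (h : DetectedByProjFD k C) {X : RComod k C} (hX : injSF k C X) :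
    projFD k C ((nakayamaL k C).obj X) := by
  obtain ⟨P, i, r, hP, hir⟩ := exists_retract_nakayamaR h hX
  have := isIso_unitHom hP
  refine projFD_of_retract ((nakayamaL k C).map i ≫ inv (unitHom P))
    (unitHom P ≫ (nakayamaL k C).map r) ?_ hP
  rw [Category.assoc, IsIso.inv_hom_id_assoc, ← Functor.map_comp, hir,
    CategoryTheory.Functor.map_id]

theorem isIso_counitHom (h : DetectedByProjFD k C) {X : RComod k C} (hX : injSF k C X) :
    IsIso (counitHom X) := by
  obtain ⟨P, i, r, hP, hir⟩ := exists_retract_nakayamaR h hX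
  have := isIso_unitHom hP
  have hc : IsIso (counitHom ((nakayamaR k C).obj P)) :=
    (isIso_comp_left_iff ((nakayamaR k C).map (unitHom P)) _).1 (by
      rw [map_unitHom_counitHom]; infer_instance)
  have hnat := counitHom_naturality i
  have hnat' := counitHom_naturality r
  -- The counit at `X` is a retract of the counit at `C ⊗_{C*} P`.
  refine ⟨i ≫ inv (counitHom ((nakayamaR k C).obj P)) ≫
    (nakayamaR k C).map ((nakayamaL k C).map r), ?_, ?_⟩
  · rw [← Category.assoc, hnat, Category.assoc, IsIso.hom_inv_id_assoc, ← Functor.map_comp,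
      ← Functor.map_comp, hir, CategoryTheory.Functor.map_id, CategoryTheory.Functor.map_id]
  · rw [Category.assoc, Category.assoc, ← hnat', IsIso.inv_hom_id_assoc, hir]

section equivalence

variable (hL : ∀ X, injSF k C X → projFD k C ((nakayamaL k C).obj X))
  (hR : ∀ X, projFD k C X → injSF k C ((nakayamaR k C).obj X))

/-- The restricted unit, an isomorphism of functors. -/
noncomputable def unitIso : 𝟭 (projFD k C).FullSubcategory ≅
    restrictFunctor (nakayamaR k C) _ _ hR ⋙ restrictFunctor (nakayamaL k C) _ _ hL :=
  NatIso.ofComponents (fun P =>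
    have := isIso_unitHom P.property
    ObjectProperty.isoMk _ (asIso (unitHom P.obj))) fun g =>
      ObjectProperty.hom_ext _ (unitHom_naturality g.hom)

/-- The restricted counit, an isomorphism of functors. -/
noncomputable def counitIso (h : DetectedByProjFD k C) :
    restrictFunctor (nakayamaL k C) _ _ hL ⋙ restrictFunctor (nakayamaR k C) _ _ hR ≅
      𝟭 (injSF k C).FullSubcategory :=
  NatIso.ofComponents (fun X =>
    have := isIso_counitHom h X.property
    ObjectProperty.isoMk _ (asIso (counitHom X.obj))) fun g =>
      ObjectProperty.hom_ext _ (counitHom_naturality g.hom).symm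

end equivalence

theorem restrictsToEquivalence_nakayamaL (h : DetectedByProjFD k C) :
    RestrictsToEquivalence (nakayamaL k C) (injSF k C) (projFD k C) :=
  have hL := fun X => projFD_nakayamaL h (X := X)
  have hR := fun X => injSF_nakayamaR (P := X)
  ⟨hL, .mk' (restrictFunctor (nakayamaR k C) _ _ hR) (counitIso hL hR h).symm
    (unitIso hL hR).symm⟩

theorem restrictsToEquivalence_nakayamaR (h : DetectedByProjFD k C) :
    RestrictsToEquivalence (nakayamaR k C) (projFD k C) (injSF k C) :=
  have hL := fun X => projFD_nakayamaL h (X := X)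
  have hR := fun X => injSF_nakayamaR (P := X)
  ⟨hR, .mk' (restrictFunctor (nakayamaL k C) _ _ hL) (unitIso hL hR) (counitIso hL hR h)⟩

/-- If the injective hull of a simple comodule `S` has the form `C ⊗_{C*} P`, then `P` maps onto
`S`. -/
theorem exists_hom_of_iso_nakayamaR {S E P : RComod k C} [Simple S] {i : S ⟶ E}
    (hi : IsInjectiveHull i) (hP : projFD k C P) (e : E ≅ (nakayamaR k C).obj P) :
    ∃ g : P ⟶ S, g ≠ 0 := by
  have := hi.mono
  refine (nonempty_dualBasis hP).some.exists_hom_of_hom_tensor (g := i ≫ e.hom)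
    fun (h0 : i ≫ e.hom = 0) => ?_
  apply id_nonzero S
  rw [← cancel_mono (i ≫ e.hom), h0, Limits.comp_zero, Limits.comp_zero]

theorem detectedByProjFD_of_nakayamaL
    (h : RestrictsToEquivalence (nakayamaL k C) (injSF k C) (projFD k C)) :
    DetectedByProjFD k C := by
  obtain ⟨hL, hequiv⟩ := h
  refine detectedByProjFD_of_simple fun S _ => ?_
  obtain ⟨E, i, hi⟩ := exists_injectiveHull S
  have hE := injSF_of_isInjectiveHull hi
  let X : (injSF k C).FullSubcategory := ⟨E, hE⟩
  let Y : (injSF k C).FullSubcategory := ⟨_, injSF_nakayamaR (hL E hE)⟩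
  have := isIso_unitHom (hL E hE)
  -- The unit identifies the images of `E` and of `C ⊗_{C*} Hom^C(C, E)^rat`.
  let e : X ≅ Y := (restrictFunctor (nakayamaL k C) _ _ hL).preimageIso
    (ObjectProperty.isoMk _ (asIso (unitHom ((nakayamaL k C).obj E))))
  exact ⟨_, hL E hE, exists_hom_of_iso_nakayamaR hi (hL E hE) ((injSF k C).ι.mapIso e)⟩

theorem detectedByProjFD_of_nakayamaR
    (h : RestrictsToEquivalence (nakayamaR k C) (projFD k C) (injSF k C)) :
    DetectedByProjFD k C := by
  obtain ⟨hR, hequiv⟩ := h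
  refine detectedByProjFD_of_simple fun S _ => ?_
  obtain ⟨E, i, hi⟩ := exists_injectiveHull S
  let X : (injSF k C).FullSubcategory := ⟨E, injSF_of_isInjectiveHull hi⟩
  let e := (restrictFunctor (nakayamaR k C) _ _ hR).objObjPreimageIso X
  exact ⟨_, ((restrictFunctor (nakayamaR k C) _ _ hR).objPreimage X).property,
    exists_hom_of_iso_nakayamaR hi
      ((restrictFunctor (nakayamaR k C) _ _ hR).objPreimage X).property
      ((injSF k C).ι.mapIso e).symm⟩

/-- For a simple comodule with injective hull `E` and projective cover `P`, the comodule `E` is a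
direct summand of `C ⊗_{C*} P`, so `Hom^C(C, E)^rat` is a nonzero direct summand of `P`. It is all
of `P`, since a projective cover of a simple object is indecomposable. -/
theorem nakayamaL_hull_iso_cover (h : DetectedByProjFD k C) {S E P : RComod k C} [Simple S]
    {i : S ⟶ E} {π : P ⟶ S} (hi : IsInjectiveHull i) (hπ : IsProjectiveCover π) :
    Nonempty ((nakayamaL k C).obj E ≅ P) := by
  have := hi.mono
  have := hi.injective
  have hepi := hπ.epi
  have hP : projFD k C P :=
    projFD_of_projective hπ.projective (finDim_of_isProjectiveCover (finDim_of_simple S) hπ)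
  have hπ0 : π ≠ 0 := by
    rintro rfl
    exact id_nonzero S (by rw [← cancel_epi (0 : P ⟶ S), Limits.zero_comp, Limits.zero_comp])
  obtain ⟨j, hj⟩ : ∃ j : S ⟶ (nakayamaR k C).obj P, j ≠ 0 :=
    (nonempty_dualBasis hP).some.exists_hom_tensor_of_hom hπ0
  have := (injSF_nakayamaR hP).1
  have hu : i ≫ Injective.factorThru j i = j := Injective.comp_factorThru j i
  have : Mono (Injective.factorThru j i) := hi.essential _ (by
    rw [hu]
    exact mono_of_injective (injective_of_simple hj))
  let u : E ⟶ (nakayamaR k C).obj P := Injective.factorThru j i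
  let r : (nakayamaR k C).obj P ⟶ E := Injective.factorThru (𝟙 E) (Injective.factorThru j i)
  have hur : u ≫ r = 𝟙 E := Injective.comp_factorThru _ _
  have := isIso_unitHom hP
  obtain ⟨a, b, hab⟩ : ∃ (a : (nakayamaL k C).obj E ⟶ P) (b : P ⟶ (nakayamaL k C).obj E),
      a ≫ b = 𝟙 _ := by
    refine ⟨(nakayamaL k C).map u ≫ inv (unitHom P), unitHom P ≫ (nakayamaL k C).map r, ?_⟩
    rw [Category.assoc, IsIso.inv_hom_id_assoc, ← Functor.map_comp, hur,
      CategoryTheory.Functor.map_id]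
  by_cases hba : (b ≫ a) ≫ π = 0
  · have h1 : Epi (𝟙 P - b ≫ a) := hπ.essential _ (by
      rw [Preadditive.sub_comp, hba, Category.id_comp, sub_zero]
      exact hepi)
    have h2 : b ≫ a = 0 := by
      rw [← cancel_epi (𝟙 P - b ≫ a), Preadditive.sub_comp, Category.id_comp, Category.assoc,
        ← Category.assoc a b, hab, Category.id_comp, sub_self, Limits.comp_zero]
    have h3 : 𝟙 ((nakayamaL k C).obj E) = 0 := by
      rw [← hab, ← Category.comp_id (a ≫ b), ← hab, Category.assoc, ← Category.assoc b, h2,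
        Limits.zero_comp, Limits.comp_zero]
    have h4 : 𝟙 ((nakayamaR k C).obj ((nakayamaL k C).obj E)) = 0 := by
      rw [← CategoryTheory.Functor.map_id, h3, nakayamaR_map_zero]
    have := isIso_counitHom h (injSF_of_isInjectiveHull hi)
    have h5 : 𝟙 E = 0 := by
      rw [← cancel_epi (counitHom E), Limits.comp_zero, Category.comp_id,
        ← Category.id_comp (counitHom E), h4, Limits.zero_comp]
    have h6 : 𝟙 S = 0 := by
      rw [← cancel_mono i, Category.id_comp, ← Category.comp_id i, h5, Limits.comp_zero,
        Limits.comp_zero]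
    exact absurd h6 (id_nonzero S)
  · have h1 : Epi (b ≫ a) := hπ.essential _ (epi_of_surjective (surjective_of_simple hba))
    have h2 : b ≫ a = 𝟙 P := by
      rw [← cancel_epi (b ≫ a), Category.assoc, ← Category.assoc a, hab, Category.id_comp,
        Category.comp_id]
    exact ⟨⟨a, b, hab, h2⟩⟩

end RComod

theorem mainTheorem2 (k C : Type u) [Field k] [AddCommGroup C] [Module k C] [Coalgebra k C] :
    List.TFAE
      [IsRightSemiperfect k C,
        RestrictsToEquivalence (RComod.nakayamaL k C) (RComod.injSF k C) (RComod.projFD k C),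
        RestrictsToEquivalence (RComod.nakayamaR k C) (RComod.projFD k C) (RComod.injSF k C)] ∧
    (IsRightSemiperfect k C →
      (∃ (hL : ∀ X, RComod.injSF k C X → RComod.projFD k C ((RComod.nakayamaL k C).obj X))
        (hR : ∀ X, RComod.projFD k C X → RComod.injSF k C ((RComod.nakayamaR k C).obj X)),
        Nonempty (restrictFunctor (RComod.nakayamaL k C) _ _ hL ⋙
          restrictFunctor (RComod.nakayamaR k C) _ _ hR ≅ 𝟭 _) ∧
        Nonempty (restrictFunctor (RComod.nakayamaR k C) _ _ hR ⋙
          restrictFunctor (RComod.nakayamaL k C) _ _ hL ≅ 𝟭 _)) ∧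
      ∀ S : RComod k C, Simple S →
        (∃ (E : RComod k C) (i : S ⟶ E), IsInjectiveHull i) ∧
        (∃ (P : RComod k C) (π : P ⟶ S), IsProjectiveCover π) ∧
        ∀ (E P : RComod k C) (i : S ⟶ E) (π : P ⟶ S),
          IsInjectiveHull i → IsProjectiveCover π →
            Nonempty ((RComod.nakayamaL k C).obj E ≅ P) ∧
            Nonempty ((RComod.nakayamaR k C).obj P ≅ E)) := by
  refine ⟨?_, fun hsemi => ?_⟩
  · tfae_have 1 → 2 := fun h =>
      RComod.restrictsToEquivalence_nakayamaL (RComod.detectedByProjFD_of_isRightSemiperfect h)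
    tfae_have 1 → 3 := fun h =>
      RComod.restrictsToEquivalence_nakayamaR (RComod.detectedByProjFD_of_isRightSemiperfect h)
    tfae_have 2 → 1 := fun h => RComod.isRightSemiperfect_of_detectedByProjFD
      (RComod.detectedByProjFD_of_nakayamaL h)
    tfae_have 3 → 1 := fun h => RComod.isRightSemiperfect_of_detectedByProjFD
      (RComod.detectedByProjFD_of_nakayamaR h)
    tfae_finish
  · have h := RComod.detectedByProjFD_of_isRightSemiperfect hsemi
    refine ⟨⟨fun X => RComod.projFD_nakayamaL h, fun X => RComod.injSF_nakayamaR,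
      ⟨RComod.counitIso _ _ h⟩, ⟨(RComod.unitIso _ _).symm⟩⟩, fun S hS => ?_⟩
    refine ⟨RComod.exists_injectiveHull S, hsemi S (RComod.finDim_of_simple S),
      fun E P i π hi hπ => ?_⟩
    obtain ⟨e⟩ := RComod.nakayamaL_hull_iso_cover h hi hπ
    have := RComod.isIso_counitHom h (RComod.injSF_of_isInjectiveHull hi)
    exact ⟨⟨e⟩, ⟨(RComod.nakayamaR k C).mapIso e.symm ≪≫ asIso (RComod.counitHom E)⟩⟩
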